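/- Conventions. Graphs are finite, non-empty and undirected, and may have multiple edges and multiple loops; each edge, loops included, gives two distinct directed edges $e$ and $\bar e$, inverse to each other. A graph is $(q+1)$-regular if each vertex is the origin of exactly $q+1$ directed edges, and the entry $A_{ab}$ of its adjacency matrix $A$ is the number of directed edges from $a$ to $b$. A walk of length $r$ is a sequence of vertices $v_0,\dots,v_r$ and directed edges $e_0,\dots,e_{r-1}$ with $e_i$ going from $v_i$ to $v_{i+1}$. It is closed if $v_0=v_r$, and non-backtracking if $e_i\neq\overline{e_{i+1}}$ for $0\le i\le r-2$. A circuit is a closed non-backtracking walk of length $r\ge 1$ with $e_0\neq\overline{e_{r-1}}$. Let $f_r(G)$ be the number of closed non-backtracking walks of length $r$ in $G$, and $c_r(G)$ the number of circuits of length $r$ in $G$ (walks with different starting points are counted separately). For a $(q+1)$-regular graph $G=(V,E)$ with $q\ge 1$ let $$\mu(G)=\frac1{|V|}\sum_{k=1}^{|V|}\delta_{q^{-1/2}\lambda_k},$$ where $\lambda_1,\dots,\lambda_{|V|}$ are the eigenvalues of $A$ with multiplicity, and let $\mu_\infty$ be the semicircle distribution $d\mu_\infty(x)=\frac1{2\pi}\sqrt{4-x^2}\,\mathbf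 1_{|x|\le 2}\,dx$. For $p\in[1,\infty)$ let $P_p(\mathbb R)$ be the set of Borel probability measures on $\mathbb R$ with finite $p$-th absolute moment, with the metric $$W_p(\mu,\nu)=\inf_{\gamma}\Big(\int_{\mathbb R^2}|x-y|^p\,d\gamma(x,y)\Big)^{1/p},$$ the infimum being over all couplings $\gamma$ of $\mu$ and $\nu$. Write $F_\mu^{-1}(x)=\inf\{y:\mu((-\infty,y])\ge x\}$ for the generalized inverse distribution function of $\mu$. **Theorem.** Let $(q_n)$ be a sequence of positive integers, let $G_n=(V_n,E_n)$ be a sequence of finite non-empty $(q_n+1)$-regular graphs, and put $\mu_n=\mu(G_n)$. The following are equivalent: 1. for every $p\in[1,\infty)$, $\mu_n\to\mu_\infty$ in $(P_p(\mathbb R),W_p)$ as $n\to\infty$; 2. for every $p\in[1,\infty)$, $F_{\mu_n}^{-1}\to F_{\mu_\infty}^{-1}$ in $L^p[0,1]$ as $n\to\infty$; 3. $\mu_n$ converges to $\mu_\infty$ in moments, that is, $\int P\,d\mu_n\to\int P\,d\mu_\infty$ for every polynomial $P\in\mathbb R[x]$; 4. $q_n\to\infty$, and for every integer $r\ge 1$,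 $q_n^{-r/2}\,c_r(G_n)/|V_n|\to 0$ as $n\to\infty$; 5. $q_n\to\infty$, and for every integer $r\ge 1$, $q_n^{-r/2}\,f_r(G_n)/|V_n|\to 0$ as $n\to\infty$. -/

import Mathlib

open MeasureTheory Filter Topology

noncomputable section

/-- An undirected graph with vertex set `V`, possibly with multiple edges and multiple loops,
presented by its set `D` of directed edges: `src` is the origin of a directed edge and `inv` is
its inverse.  The inversion is an involution without fixed points, so that an undirected edge
(loops included) is a pair `{d, inv d}` of two distinct directed edges. -/
structure DartGraph (V : Type*) (D : Type*) where
  src : D → V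
  inv : D → D
  inv_inv : ∀ d, inv (inv d) = d
  inv_ne : ∀ d, inv d ≠ d

namespace DartGraph

variable {V D : Type*}

/-- The terminus of a directed edge. -/
def tgt (G : DartGraph V D) (d : D) : V := G.src (G.inv d)

/-- Every vertex is the origin of exactly `k` directed edges (a loop counts twice). -/
def IsRegularOfDegree (G : DartGraph V D) (k : ℕ) : Prop :=
  ∀ v : V, Nat.card {d : D // G.src d = v} = k

/-- A walk of length `n`: vertices `v₀, …, vₙ` and directed edges `e₀, …, eₙ₋₁` with `eᵢ` going
from `vᵢ` to `vᵢ₊₁`. -/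
structure Walk (G : DartGraph V D) (n : ℕ) where
  vert : Fin (n + 1) → V
  dart : Fin n → D
  src_dart : ∀ i, G.src (dart i) = vert i.castSucc
  tgt_dart : ∀ i, G.tgt (dart i) = vert i.succ

namespace Walk

variable {G : DartGraph V D} {n : ℕ}

def IsClosed (w : G.Walk n) : Prop := w.vert 0 = w.vert (Fin.last n)

/-- No directed edge of the walk is immediately followed by its inverse. -/
def IsNonBacktracking (w : G.Walk n) : Prop :=
  ∀ i j : Fin n, (j : ℕ) = i + 1 → w.dart i ≠ G.inv (w.dart j)

/-- A circuit: a closed non-backtracking walk of positive length whose first directed edge is not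
the inverse of its last one. -/
def IsCircuit (w : G.Walk n) : Prop :=
  w.IsClosed ∧ w.IsNonBacktracking ∧
    ∃ h : 0 < n, w.dart ⟨0, h⟩ ≠ G.inv (w.dart ⟨n - 1, Nat.sub_lt h Nat.one_pos⟩)

end Walk

/-- `f_r(G)`: the number of closed non-backtracking walks of length `r`. -/
def closedNBWalkCount (G : DartGraph V D) (r : ℕ) : ℕ :=
  Nat.card {w : G.Walk r // w.IsClosed ∧ w.IsNonBacktracking}

/-- `c_r(G)`: the number of circuits of length `r`. -/
def circuitCount (G : DartGraph V D) (r : ℕ) : ℕ :=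
  Nat.card {w : G.Walk r // w.IsCircuit}

/-- The adjacency matrix: the entry at `(a, b)` is the number of directed edges from `a` to `b`. -/
def adjMatrix (G : DartGraph V D) : Matrix V V ℝ :=
  fun a b => (Nat.card {d : D // G.src d = a ∧ G.tgt d = b} : ℝ)

theorem adjMatrix_isHermitian (G : DartGraph V D) : G.adjMatrix.IsHermitian := by
  ext a b
  simp only [Matrix.conjTranspose_apply, adjMatrix, star_trivial, Nat.cast_inj]
  refine Nat.card_congr ⟨fun d => ⟨G.inv d.1, ?_⟩, fun d => ⟨G.inv d.1, ?_⟩, ?_, ?_⟩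
  · exact ⟨d.2.2, by simpa [tgt, G.inv_inv] using d.2.1⟩
  · exact ⟨d.2.2, by simpa [tgt, G.inv_inv] using d.2.1⟩
  · intro d; simp [G.inv_inv]
  · intro d; simp [G.inv_inv]

/-- The normalized spectral measure of a finite `(q+1)`-regular graph: the uniform probability
measure on the numbers `q^{-1/2} λ`, where `λ` runs through the eigenvalues of the adjacency
matrix, counted with multiplicity. -/
def spectralMeasure [Fintype V] [DecidableEq V] (G : DartGraph V D) (q : ℕ) : Measure ℝ :=
  (Fintype.card V : ENNReal)⁻¹ •
    ∑ k : V, Measure.dirac ((q : ℝ) ^ (-(1 / 2) : ℝ) * G.adjMatrix_isHermitian.eigenvalues k)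

end DartGraph

/-- The Wigner semicircle distribution on `[-2, 2]`. -/
def semicircle : Measure ℝ :=
  (volume.restrict (Set.Icc (-2) 2)).withDensity
    fun x => ENNReal.ofReal (1 / (2 * Real.pi) * √(4 - x ^ 2))

/-- `μ` belongs to `P_p(ℝ)`: it is a probability measure with finite `p`-th absolute moment. -/
def MemWassersteinSpace (p : ℝ) (μ : Measure ℝ) : Prop :=
  IsProbabilityMeasure μ ∧ Integrable (fun x : ℝ => |x| ^ p) μ

/-- The couplings of `μ` and `ν`. -/
def couplings (μ ν : Measure ℝ) : Set (Measure (ℝ × ℝ)) :=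
  {γ | γ.map Prod.fst = μ ∧ γ.map Prod.snd = ν}

/-- The Wasserstein distance `W_p`, with values in `[0, ∞]`. -/
def wassersteinDist (p : ℝ) (μ ν : Measure ℝ) : ENNReal :=
  ⨅ γ ∈ couplings μ ν, (∫⁻ z : ℝ × ℝ, ENNReal.ofReal (|z.1 - z.2| ^ p) ∂γ) ^ (1 / p)

/-- `μ n → ν` in the metric space `(P_p(ℝ), W_p)`. -/
def ConvergesInWasserstein (p : ℝ) (μ : ℕ → Measure ℝ) (ν : Measure ℝ) : Prop :=
  (∀ n, MemWassersteinSpace p (μ n)) ∧ MemWassersteinSpace p ν ∧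
    Tendsto (fun n => wassersteinDist p (μ n) ν) atTop (𝓝 0)

/-- The generalized inverse distribution function `F_μ⁻¹(x) = inf {y | μ((-∞, y]) ≥ x}`. -/
def invDistribFun (μ : Measure ℝ) (x : ℝ) : ℝ :=
  sInf {y : ℝ | ENNReal.ofReal x ≤ μ (Set.Iic y)}

/-- `f n → g` in `L^p[0,1]`. -/
def ConvergesInLpUnitInterval (p : ℝ) (f : ℕ → ℝ → ℝ) (g : ℝ → ℝ) : Prop :=
  (∀ n, MemLp (f n) (ENNReal.ofReal p) (volume.restrict (Set.Icc 0 1))) ∧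
    MemLp g (ENNReal.ofReal p) (volume.restrict (Set.Icc 0 1)) ∧
    Tendsto (fun n => eLpNorm (f n - g) (ENNReal.ofReal p) (volume.restrict (Set.Icc 0 1)))
      atTop (𝓝 0)

/-- Convergence in moments, for probability measures all of whose moments are finite. -/
def ConvergesInMoments (μ : ℕ → Measure ℝ) (ν : Measure ℝ) : Prop :=
  (∀ n, ∀ p : ℝ, 1 ≤ p → MemWassersteinSpace p (μ n)) ∧
    (∀ p : ℝ, 1 ≤ p → MemWassersteinSpace p ν) ∧
    ∀ P : Polynomial ℝ,
      Tendsto (fun n => ∫ x, P.eval x ∂(μ n)) atTop (𝓝 (∫ x, P.eval x ∂ν))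

end

/-! The bridge between graphs and spectra is one identity. Let T and S be the dart–terminus and
origin–dart incidence matrices, J the inversion of darts, and B = TS - J the non-backtracking
matrix. Then ST = A, circuits are counted by tr B^r, and closed non-backtracking walks by the trace
of S B^(r-1) T. Regularity gives the latter matrices a three-term recurrence
(`nbWalkMatrix_add_two`), which after scaling by q^(-1/2) is that of the Chebyshev polynomials S_r,
with S_r(2 cos θ) = sin((r+1)θ)/sin θ. Hence q^(-r/2) f_r/|V| = ∫ S_r dμ - q^(-1) ∫ S_(r-2) dμ
(`integral_chebyshev_spectralMeasure`).

The S_r span all polynomials and have semicircle integral 0 for r ≥ 1, so moment convergence means ∫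
S_r dμ_n → 0 for every r ≥ 1. The identity turns this into the decay of f_r as soon as q_n → ∞;
conversely its case r = 2 forces q_n → ∞, because f_2 ≥ 0. Circuits and closed walks are compared
through f_(r+2) = c_(r+2) + q f_r - c_r (`closedNBWalkCount_add_three`): multiplication by q is
exactly the change of normalization from r+2 to r.

The analytic conditions form the cycle 1 → 3 → 2 → 1. A coupling with small k-th cost controls k-th
moments, since the limit lives on [-2, 2]. Moments convergent to those of such a limit give small
tails, hence weak convergence by Weierstrass approximation, convergence of quantiles on (0, 1), and
L^p convergence by truncation. Finally the comonotone coupling bounds W_p by the L^p distance of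
quantile functions; equality is not needed. -/

/-- The weighted sum over paths of length `n` expressed through the `n`-th power of the weight
matrix. -/
theorem Matrix.sum_paths_eq_sum_pow {ι R : Type*} [Fintype ι] [DecidableEq ι] [CommSemiring R]
    (T : Matrix ι ι R) (n : ℕ) (F : ι → ι → R) :
    ∑ e : Fin (n + 1) → ι, F (e 0) (e (Fin.last n)) * ∏ i : Fin n, T (e i.castSucc) (e i.succ) =
      ∑ a, ∑ b, F a b * (T ^ n) a b := by
  induction n generalizing F with
  | zero =>
    rw [← (Equiv.funUnique (Fin 1) ι).symm.sum_comp]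
    simp [Matrix.one_apply]
  | succ n ih =>
    rw [← (Fin.consEquiv fun _ => ι).sum_comp, Fintype.sum_prod_type_right]
    simp only [Fin.consEquiv_apply, Fin.cons_zero, Fin.prod_univ_succ, ← Fin.succ_last,
      Fin.cons_succ, Fin.castSucc_zero, ← Fin.succ_castSucc]
    -- The first vertex c of the longer path is summed into the endpoint weight, leaving a path that
    -- starts at the second vertex.
    have h := ih fun a b => ∑ c, F c b * T c a
    simp only [Finset.sum_mul] at h
    calc _ = _ := by
          simp only [← mul_assoc]
          exact h
      _ = ∑ a, ∑ b, ∑ c, F c b * T c a * (T ^ n) a b := rfl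
      _ = ∑ b, ∑ c, ∑ a, F c b * T c a * (T ^ n) a b := by
          rw [Finset.sum_comm]
          exact Finset.sum_congr rfl fun b _ => Finset.sum_comm
      _ = _ := by
          rw [Finset.sum_comm]
          simp only [pow_succ', Matrix.mul_apply, Finset.mul_sum, mul_assoc]

/-! ### Walks as dart sequences and their counts as traces -/

namespace DartGraph

variable {V D : Type*}

/-- The darts of a regular graph on finitely many vertices are finite in number. -/
theorem IsRegularOfDegree.finite_darts [Finite V] {G : DartGraph V D} {k : ℕ}
    (hG : G.IsRegularOfDegree (k + 1)) : Finite D := by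
  -- `Nat.card` is 0 on infinite types, so it is the positive degree that makes the fibres finite.
  have : ∀ v, Finite {d : D // G.src d = v} := fun v =>
    Nat.finite_of_card_ne_zero (by rw [hG v]; omega)
  exact Finite.of_equiv _ (Equiv.sigmaFiberEquiv G.src)

/-- The second dart may follow the first one in a non-backtracking walk. -/
def Follows (G : DartGraph V D) (d e : D) : Prop := G.tgt d = G.src e ∧ d ≠ G.inv e

theorem tgt_inv (G : DartGraph V D) (d : D) : G.tgt (G.inv d) = G.src d := by
  rw [tgt, G.inv_inv]

theorem eq_inv_comm (G : DartGraph V D) {d e : D} : d = G.inv e ↔ e = G.inv d :=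
  ⟨fun h => by rw [h, G.inv_inv], fun h => by rw [h, G.inv_inv]⟩

/-- A walk of positive length is determined by its darts. -/
def walkEquiv (G : DartGraph V D) (n : ℕ) :
    G.Walk (n + 1) ≃
      {e : Fin (n + 1) → D // ∀ i : Fin n, G.tgt (e i.castSucc) = G.src (e i.succ)} where
  toFun w := ⟨w.dart, fun i => by
    rw [w.tgt_dart, w.src_dart, Fin.succ_castSucc]⟩
  invFun e :=
    { vert := Fin.cons (G.src (e.1 0)) fun i => G.tgt (e.1 i)
      dart := e.1
      src_dart := fun i => by
        refine Fin.cases ?_ (fun j => ?_) i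
        · simp
        · rw [← Fin.succ_castSucc, Fin.cons_succ, e.2]
      tgt_dart := fun i => by simp }
  left_inv w := by
    obtain ⟨v, e, hs, ht⟩ := w
    have : (Fin.cons (G.src (e 0)) fun i => G.tgt (e i) : Fin (n + 2) → V) = v := by
      funext i
      refine Fin.cases ?_ (fun j => ?_) i
      · simpa using hs 0
      · simpa using ht j
    subst this
    rfl
  right_inv e := rfl

theorem card_walk_subtype (G : DartGraph V D) (n : ℕ) (P : (Fin (n + 1) → D) → Prop) :
    Nat.card {w : G.Walk (n + 1) // P w.dart} = Nat.card {e : Fin (n + 1) → D //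
      (∀ i : Fin n, G.tgt (e i.castSucc) = G.src (e i.succ)) ∧ P e} :=
  Nat.card_congr (((G.walkEquiv n).subtypeEquiv fun _ => Iff.rfl).trans
    (Equiv.subtypeSubtypeEquivSubtypeInter _ P))

theorem Walk.isClosed_iff {G : DartGraph V D} {n : ℕ} (w : G.Walk (n + 1)) :
    w.IsClosed ↔ G.tgt (w.dart (Fin.last n)) = G.src (w.dart 0) := by
  rw [w.tgt_dart, w.src_dart, Fin.succ_last, Fin.castSucc_zero, eq_comm, Walk.IsClosed]

theorem Walk.isNonBacktracking_iff {G : DartGraph V D} {n : ℕ} (w : G.Walk (n + 1)) :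
    w.IsNonBacktracking ↔ ∀ i : Fin n, w.dart i.castSucc ≠ G.inv (w.dart i.succ) := by
  refine ⟨fun h i => h _ _ (by simp), fun h i j hij => ?_⟩
  have := h ⟨i, by omega⟩
  convert! this using 3
  exact Fin.ext (by simp [hij])

/-- Since d = inv e is symmetric in d and e, closedness and the extra circuit condition together
form one more `Follows` relation. A circuit is thus a cyclic chain, whence a trace of a power of B.
-/
theorem Walk.isCircuit_iff {G : DartGraph V D} {n : ℕ} (w : G.Walk (n + 1)) :
    w.IsCircuit ↔ G.Follows (w.dart (Fin.last n)) (w.dart 0) ∧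
      ∀ i : Fin n, w.dart i.castSucc ≠ G.inv (w.dart i.succ) := by
  have h : (∃ h : 0 < n + 1, w.dart ⟨0, h⟩ ≠
      G.inv (w.dart ⟨n + 1 - 1, Nat.sub_lt h Nat.one_pos⟩)) ↔
      w.dart (Fin.last n) ≠ G.inv (w.dart 0) := by
    refine ⟨fun ⟨_, h⟩ h' => h (G.eq_inv_comm.1 h'), fun h => ⟨by omega, fun h' => h ?_⟩⟩
    exact G.eq_inv_comm.1 h'
  rw [Walk.IsCircuit, h, w.isClosed_iff, w.isNonBacktracking_iff, Follows]
  tauto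

theorem closedNBWalkCount_succ (G : DartGraph V D) (n : ℕ) :
    G.closedNBWalkCount (n + 1) = Nat.card {e : Fin (n + 1) → D //
      G.tgt (e (Fin.last n)) = G.src (e 0) ∧ ∀ i : Fin n, G.Follows (e i.castSucc) (e i.succ)} := by
  simp only [closedNBWalkCount, Walk.isClosed_iff, Walk.isNonBacktracking_iff]
  rw [G.card_walk_subtype n fun e => G.tgt (e (Fin.last n)) = G.src (e 0) ∧
    ∀ i : Fin n, e i.castSucc ≠ G.inv (e i.succ)]
  refine Nat.card_congr (Equiv.subtypeEquivRight fun e => ?_)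
  simp only [Follows, forall_and]
  tauto

theorem circuitCount_succ (G : DartGraph V D) (n : ℕ) :
    G.circuitCount (n + 1) = Nat.card {e : Fin (n + 1) → D //
      G.Follows (e (Fin.last n)) (e 0) ∧ ∀ i : Fin n, G.Follows (e i.castSucc) (e i.succ)} := by
  simp only [circuitCount, Walk.isCircuit_iff]
  rw [G.card_walk_subtype n fun e => G.Follows (e (Fin.last n)) (e 0) ∧
    ∀ i : Fin n, e i.castSucc ≠ G.inv (e i.succ)]
  refine Nat.card_congr (Equiv.subtypeEquivRight fun e => ?_)
  simp only [Follows, forall_and]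
  tauto

section Matrices

variable [DecidableEq V] [DecidableEq D]

instance (G : DartGraph V D) : DecidableRel G.Follows :=
  fun _ _ => inferInstanceAs (Decidable (_ ∧ _))

/-- The Hashimoto non-backtracking matrix. -/
noncomputable def nbMatrix (G : DartGraph V D) : Matrix D D ℝ :=
  fun d e => if G.Follows d e then 1 else 0

/-- The incidence matrix of vertices and outgoing darts. -/
noncomputable def srcMatrix (G : DartGraph V D) : Matrix V D ℝ :=
  fun v d => if G.src d = v then 1 else 0

/-- The incidence matrix of darts and their termini. -/
noncomputable def tgtMatrix (G : DartGraph V D) : Matrix D V ℝ :=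
  fun d v => if G.tgt d = v then 1 else 0

/-- The permutation matrix of the inversion of darts. -/
noncomputable def invMatrix (G : DartGraph V D) : Matrix D D ℝ :=
  fun d e => if d = G.inv e then 1 else 0

open Matrix

variable [Fintype D]

/-- The closing relation R is kept apart from Q: circuits close up by `Follows`, closed walks only
by matching endpoints. -/
theorem card_paths_eq_trace {ι : Type*} [Fintype ι] [DecidableEq ι] (R Q : ι → ι → Prop)
    [DecidableRel R] [DecidableRel Q] (n : ℕ) :
    (Nat.card {e : Fin (n + 1) → ι //
      R (e (Fin.last n)) (e 0) ∧ ∀ i : Fin n, Q (e i.castSucc) (e i.succ)} : ℝ) =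
      trace ((Matrix.of fun d e => if Q d e then (1 : ℝ) else 0) ^ n *
        Matrix.of fun d e => if R d e then (1 : ℝ) else 0) := by
  have h := Matrix.sum_paths_eq_sum_pow (Matrix.of fun d e => if Q d e then (1 : ℝ) else 0) n
    fun a b => if R b a then (1 : ℝ) else 0
  simp only [Matrix.trace, Matrix.diag, Matrix.mul_apply]
  rw [Nat.card_eq_fintype_card, Fintype.card_subtype, ← Finset.sum_boole]
  simp only [Matrix.of_apply] at h ⊢
  refine Eq.trans (Finset.sum_congr rfl fun e _ => ?_) (h.trans ?_)
  · rw [Finset.prod_ite_zero]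
    simp only [Finset.mem_univ, true_imp_iff, Finset.prod_const_one, ite_and, ite_mul, one_mul,
      zero_mul]
  · exact Finset.sum_congr rfl fun a _ => Finset.sum_congr rfl fun b _ => mul_comm _ _

omit [Fintype D] in
-- Two composable darts either follow each other without backtracking or are mutually inverse, and
-- never both.
theorem tgtMatrix_mul_srcMatrix [Fintype V] (G : DartGraph V D) :
    G.tgtMatrix * G.srcMatrix = G.nbMatrix + G.invMatrix := by
  ext d e
  simp only [Matrix.mul_apply, tgtMatrix, srcMatrix, nbMatrix, invMatrix, Matrix.add_apply,
    Follows, ite_mul, one_mul, zero_mul, Finset.sum_ite_eq, Finset.mem_univ, if_true]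
  by_cases h : d = G.inv e
  · simp [h, tgt_inv]
  · simp [h, eq_comm]

omit [DecidableEq V] in
theorem invMatrix_mul_apply {W : Type*} (G : DartGraph V D) (M : Matrix D W ℝ) (d : D) (w : W) :
    (G.invMatrix * M) d w = M (G.inv d) w := by
  simp only [Matrix.mul_apply, invMatrix, G.eq_inv_comm, ite_mul, one_mul, zero_mul,
    Finset.sum_ite_eq', Finset.mem_univ, if_true]

theorem invMatrix_mul_tgtMatrix (G : DartGraph V D) :
    G.invMatrix * G.tgtMatrix = G.srcMatrixᵀ := by
  ext d v
  simp only [invMatrix_mul_apply, tgtMatrix, srcMatrix, tgt_inv, Matrix.transpose_apply]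

theorem invMatrix_mul_srcMatrix_transpose (G : DartGraph V D) :
    G.invMatrix * G.srcMatrixᵀ = G.tgtMatrix := by
  ext d v
  rw [invMatrix_mul_apply]
  rfl

omit [DecidableEq V] in
theorem invMatrix_mul_self (G : DartGraph V D) : G.invMatrix * G.invMatrix = 1 := by
  ext d e
  rw [invMatrix_mul_apply, Matrix.one_apply, invMatrix]
  exact if_congr ⟨fun h => by rw [← G.inv_inv d, h, G.inv_inv], fun h => by rw [h]⟩ rfl rfl

omit [DecidableEq V] [Fintype D] in
theorem invMatrix_transpose (G : DartGraph V D) : G.invMatrixᵀ = G.invMatrix := by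
  ext d e
  exact if_congr G.eq_inv_comm rfl rfl

theorem srcMatrix_mul_invMatrix (G : DartGraph V D) :
    G.srcMatrix * G.invMatrix = G.tgtMatrixᵀ := by
  rw [← G.invMatrix_mul_srcMatrix_transpose, Matrix.transpose_mul, Matrix.transpose_transpose,
    invMatrix_transpose]

omit [DecidableEq D] in
theorem srcMatrix_mul_tgtMatrix (G : DartGraph V D) :
    G.srcMatrix * G.tgtMatrix = G.adjMatrix := by
  ext a b
  simp only [Matrix.mul_apply, srcMatrix, tgtMatrix, adjMatrix]
  rw [Nat.card_eq_fintype_card, Fintype.card_subtype, ← Finset.sum_boole]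
  exact Finset.sum_congr rfl fun d _ => by
    split_ifs <;> simp_all

omit [DecidableEq D] in
theorem IsRegularOfDegree.srcMatrix_mul_transpose {G : DartGraph V D} {k : ℕ}
    (hG : G.IsRegularOfDegree k) : G.srcMatrix * G.srcMatrixᵀ = (k : ℝ) • 1 := by
  ext a b
  simp only [Matrix.mul_apply, srcMatrix, Matrix.transpose_apply, Matrix.smul_apply,
    Matrix.one_apply, smul_eq_mul, mul_ite, mul_one, mul_zero]
  split_ifs with h
  · subst h
    rw [← hG a, Nat.card_eq_fintype_card, Fintype.card_subtype, ← Finset.sum_boole]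
    exact Finset.sum_congr rfl fun d _ => by split_ifs <;> rfl
  · refine Finset.sum_eq_zero fun d _ => ?_
    split_ifs with h1 h2
    · exact absurd (h2.symm.trans h1) h
    · rfl
    · rfl

omit [DecidableEq V] in
theorem trace_invMatrix (G : DartGraph V D) : trace G.invMatrix = 0 :=
  Finset.sum_eq_zero fun d _ => if_neg fun h => G.inv_ne d h.symm

omit [DecidableEq D] in
theorem trace_tgtMatrix_mul_transpose [Fintype V] (G : DartGraph V D) :
    trace (G.tgtMatrix * G.tgtMatrixᵀ) = Fintype.card D := by
  simp [Matrix.trace, Matrix.mul_apply, tgtMatrix]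

theorem circuitCount_succ_eq_trace (G : DartGraph V D) (n : ℕ) :
    (G.circuitCount (n + 1) : ℝ) = trace (G.nbMatrix ^ (n + 1)) := by
  rw [circuitCount_succ, card_paths_eq_trace, pow_succ]
  rfl

theorem closedNBWalkCount_succ_eq_trace [Fintype V] (G : DartGraph V D) (n : ℕ) :
    (G.closedNBWalkCount (n + 1) : ℝ) = trace (G.nbMatrix ^ n * (G.tgtMatrix * G.srcMatrix)) := by
  rw [closedNBWalkCount_succ, card_paths_eq_trace (fun d e => G.tgt d = G.src e)]
  congr 2
  ext d e
  simp [Matrix.mul_apply, tgtMatrix, srcMatrix, eq_comm]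

end Matrices

end DartGraph

/-! ### Recurrences for non-backtracking walks -/

namespace DartGraph

open Matrix Polynomial

section NonBacktracking

variable {V D : Type*} [Fintype V] [DecidableEq V] [Fintype D] [DecidableEq D]

/-- The matrix counting the non-backtracking walks of length `n + 1` by their end points. -/
noncomputable def nbWalkMatrix (G : DartGraph V D) (n : ℕ) : Matrix V V ℝ :=
  G.srcMatrix * G.nbMatrix ^ n * G.tgtMatrix

omit [Fintype D] in
theorem nbMatrix_eq (G : DartGraph V D) :
    G.nbMatrix = G.tgtMatrix * G.srcMatrix - G.invMatrix := by
  rw [tgtMatrix_mul_srcMatrix, add_sub_cancel_right]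

omit [Fintype V] in
theorem nbWalkMatrix_zero (G : DartGraph V D) : G.nbWalkMatrix 0 = G.adjMatrix := by
  rw [nbWalkMatrix, pow_zero, Matrix.mul_one, srcMatrix_mul_tgtMatrix]

theorem nbMatrix_mul_tgtMatrix (G : DartGraph V D) :
    G.nbMatrix * G.tgtMatrix = G.tgtMatrix * G.adjMatrix - G.srcMatrixᵀ := by
  rw [nbMatrix_eq, Matrix.sub_mul, Matrix.mul_assoc, srcMatrix_mul_tgtMatrix,
    invMatrix_mul_tgtMatrix]

theorem nbMatrix_mul_invMatrix (G : DartGraph V D) :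
    G.nbMatrix * G.invMatrix = G.tgtMatrix * G.tgtMatrixᵀ - 1 := by
  rw [nbMatrix_eq, Matrix.sub_mul, Matrix.mul_assoc, srcMatrix_mul_invMatrix, invMatrix_mul_self]

namespace IsRegularOfDegree

variable {G : DartGraph V D} {q : ℕ}

theorem nbMatrix_mul_srcMatrix_transpose (hG : G.IsRegularOfDegree (q + 1)) :
    G.nbMatrix * G.srcMatrixᵀ = (q : ℝ) • G.tgtMatrix := by
  rw [nbMatrix_eq, Matrix.sub_mul, Matrix.mul_assoc, hG.srcMatrix_mul_transpose,
    invMatrix_mul_srcMatrix_transpose, Matrix.mul_smul, Matrix.mul_one]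
  push_cast
  rw [add_smul, one_smul, add_sub_cancel_right]

theorem tgtMatrix_transpose_mul_nbMatrix (hG : G.IsRegularOfDegree (q + 1)) :
    G.tgtMatrixᵀ * G.nbMatrix = (q : ℝ) • G.srcMatrix := by
  rw [← srcMatrix_mul_invMatrix, nbMatrix_eq, Matrix.mul_sub, Matrix.mul_assoc _ _ G.invMatrix,
    invMatrix_mul_self, Matrix.mul_one, Matrix.mul_assoc, ← Matrix.mul_assoc G.invMatrix,
    invMatrix_mul_tgtMatrix, ← Matrix.mul_assoc, hG.srcMatrix_mul_transpose, Matrix.smul_mul,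
    Matrix.one_mul]
  push_cast
  rw [add_smul, one_smul, add_sub_cancel_right]

theorem nbWalkMatrix_one (hG : G.IsRegularOfDegree (q + 1)) :
    G.nbWalkMatrix 1 = G.adjMatrix * G.adjMatrix - ((q : ℝ) + 1) • 1 := by
  rw [nbWalkMatrix, pow_one, Matrix.mul_assoc, nbMatrix_mul_tgtMatrix, Matrix.mul_sub,
    ← Matrix.mul_assoc, srcMatrix_mul_tgtMatrix, hG.srcMatrix_mul_transpose]
  push_cast
  rfl

/-- Append an arbitrary dart and discard the extensions that backtrack. These undo the last dart,
and each shorter walk arises q times, its last dart having q non-backtracking successors. A walk of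
length 0 would have q + 1, which is why `nbWalkMatrix_one` is separate. -/
theorem nbWalkMatrix_add_two (hG : G.IsRegularOfDegree (q + 1)) (n : ℕ) :
    G.nbWalkMatrix (n + 2) =
      G.nbWalkMatrix (n + 1) * G.adjMatrix - (q : ℝ) • G.nbWalkMatrix n := by
  simp only [nbWalkMatrix]
  rw [pow_succ _ (n + 1), ← Matrix.mul_assoc, Matrix.mul_assoc _ G.nbMatrix,
    nbMatrix_mul_tgtMatrix, Matrix.mul_sub, ← Matrix.mul_assoc, pow_succ,
    ← Matrix.mul_assoc G.srcMatrix, Matrix.mul_assoc _ G.nbMatrix G.srcMatrixᵀ,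
    hG.nbMatrix_mul_srcMatrix_transpose, Matrix.mul_smul]

end IsRegularOfDegree

theorem closedNBWalkCount_succ_eq_trace_nbWalkMatrix (G : DartGraph V D) (n : ℕ) :
    (G.closedNBWalkCount (n + 1) : ℝ) = trace (G.nbWalkMatrix n) := by
  rw [closedNBWalkCount_succ_eq_trace, nbWalkMatrix, ← Matrix.mul_assoc, Matrix.trace_mul_comm,
    Matrix.mul_assoc]

theorem closedNBWalkCount_one (G : DartGraph V D) :
    (G.closedNBWalkCount 1 : ℝ) = G.circuitCount 1 := by
  rw [← zero_add 1, closedNBWalkCount_succ_eq_trace, circuitCount_succ_eq_trace,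
    tgtMatrix_mul_srcMatrix]
  simp [trace_invMatrix]

theorem closedNBWalkCount_two (G : DartGraph V D) :
    (G.closedNBWalkCount 2 : ℝ) = G.circuitCount 2 := by
  rw [← one_add_one_eq_two, closedNBWalkCount_succ_eq_trace, circuitCount_succ_eq_trace,
    tgtMatrix_mul_srcMatrix, pow_one, Matrix.mul_add, nbMatrix_mul_invMatrix, Matrix.trace_add,
    Matrix.trace_sub, trace_tgtMatrix_mul_transpose, Matrix.trace_one, sub_self, add_zero, sq]

/-- A closed non-backtracking walk that is not a circuit starts with a dart and ends with its
inverse. Stripping both leaves a closed walk, which arises q - 1 times if it is a circuit and q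
times otherwise. In matrix form this is BJ = TTᵀ - 1 and TᵀB = qS. -/
theorem IsRegularOfDegree.closedNBWalkCount_add_three {G : DartGraph V D} {q : ℕ}
    (hG : G.IsRegularOfDegree (q + 1)) (n : ℕ) :
    (G.closedNBWalkCount (n + 3) : ℝ) =
      G.circuitCount (n + 3) + (q * G.closedNBWalkCount (n + 1) - G.circuitCount (n + 1)) := by
  rw [closedNBWalkCount_succ_eq_trace_nbWalkMatrix G n, closedNBWalkCount_succ_eq_trace,
    circuitCount_succ_eq_trace, circuitCount_succ_eq_trace, tgtMatrix_mul_srcMatrix,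
    Matrix.mul_add, Matrix.trace_add, ← pow_succ, pow_succ _ (n + 1), Matrix.mul_assoc,
    nbMatrix_mul_invMatrix, Matrix.mul_sub, Matrix.mul_one, Matrix.trace_sub,
    ← Matrix.mul_assoc, Matrix.trace_mul_comm, pow_succ' _ n,
    ← Matrix.mul_assoc, ← Matrix.mul_assoc, hG.tgtMatrix_transpose_mul_nbMatrix,
    Matrix.smul_mul, Matrix.smul_mul,
    Matrix.trace_smul, smul_eq_mul, nbWalkMatrix]

/-- The non-backtracking walk matrices as Chebyshev polynomials of the adjacency matrix. -/
theorem IsRegularOfDegree.pow_smul_nbWalkMatrix {G : DartGraph V D} {q : ℕ}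
    (hG : G.IsRegularOfDegree (q + 1)) (hq : q ≠ 0) {s : ℝ} (hs : s ^ 2 = (q : ℝ)⁻¹) (n : ℕ) :
    s ^ (n + 1) • G.nbWalkMatrix n = aeval (s • G.adjMatrix) (Chebyshev.S ℝ ((n : ℤ) + 1)) -
      (q : ℝ)⁻¹ • aeval (s • G.adjMatrix) (Chebyshev.S ℝ ((n : ℤ) - 1)) := by
  have hq' : (q : ℝ) ≠ 0 := by exact_mod_cast hq
  induction n using Nat.twoStepInduction with
  | zero => simp [nbWalkMatrix_zero]
  | one =>
    -- The summand 1 of q + 1 becomes q^(-1) S_0 after scaling, while q becomes the constant term of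
    -- S_2 = X² - 1.
    simp only [Nat.cast_one, sub_self, Chebyshev.S_zero, map_one, one_add_one_eq_two,
      Chebyshev.S_two, map_sub, map_pow, aeval_X, hG.nbWalkMatrix_one, _root_.smul_pow]
    rw [hs, smul_sub, smul_smul, sq G.adjMatrix, mul_add, inv_mul_cancel₀ hq', mul_one, add_smul,
      one_smul]
    abel
  | more n ih1 ih2 =>
    have h1 : Chebyshev.S ℝ (((n + 2 : ℕ) : ℤ) + 1) =
        Chebyshev.S ℝ (((n + 1 : ℕ) : ℤ) + 1) * X - Chebyshev.S ℝ ((n : ℤ) + 1) := by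
      rw [Chebyshev.S_eq, mul_comm]
      push_cast
      ring_nf
    have h2 : Chebyshev.S ℝ (((n + 2 : ℕ) : ℤ) - 1) =
        Chebyshev.S ℝ (((n + 1 : ℕ) : ℤ) - 1) * X - Chebyshev.S ℝ ((n : ℤ) - 1) := by
      rw [Chebyshev.S_eq, mul_comm]
      push_cast
      ring_nf
    have h3 : s ^ (n + 2 + 1) • G.nbWalkMatrix (n + 2) =
        (s ^ (n + 1 + 1) • G.nbWalkMatrix (n + 1)) * (s • G.adjMatrix) -
          s ^ (n + 1) • G.nbWalkMatrix n := by
      rw [hG.nbWalkMatrix_add_two, smul_sub, smul_smul, Matrix.mul_smul, Matrix.smul_mul,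
        smul_smul]
      congr 2
      · ring
      · calc s ^ (n + 2 + 1) * (q : ℝ) = s ^ (n + 1) * (s ^ 2 * q) := by ring
          _ = _ := by rw [hs, inv_mul_cancel₀ hq', mul_one]
    rw [h3, ih1, ih2, h1, h2]
    simp only [map_sub, map_mul, aeval_X, Matrix.sub_mul, smul_sub, Matrix.smul_mul]
    abel

end NonBacktracking

/-! ### Spectral integrals -/

section Spectral

variable {V D : Type*} [Fintype V] [DecidableEq V]

theorem _root_.Matrix.aeval_diagonal (d : V → ℝ) (P : ℝ[X]) :
    aeval (diagonal d) P = diagonal fun k => P.eval (d k) := by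
  induction P using Polynomial.induction_on' with
  | add P Q hP hQ => simp [hP, hQ, Matrix.diagonal_add]
  | monomial n a =>
    rw [aeval_monomial, Matrix.diagonal_pow, Matrix.algebraMap_eq_diagonal,
      Matrix.diagonal_mul_diagonal]
    simp

theorem _root_.Matrix.IsHermitian.trace_aeval {A : Matrix V V ℝ} (hA : A.IsHermitian)
    (P : ℝ[X]) : trace (aeval A P) = ∑ k, P.eval (hA.eigenvalues k) := by
  have h : aeval A P = Unitary.conjStarAlgAut ℝ _ hA.eigenvectorUnitary
      (diagonal fun k => P.eval (hA.eigenvalues k)) := by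
    conv_lhs => rw [hA.spectral_theorem]
    rw [aeval_algHom_apply, Matrix.aeval_diagonal]
    rfl
  rw [h, Unitary.conjStarAlgAut_apply, Matrix.trace_mul_comm, ← mul_assoc,
    Unitary.coe_star_mul_self, one_mul, Matrix.trace_diagonal]

variable (G : DartGraph V D) (q : ℕ)

instance [Nonempty V] : IsProbabilityMeasure (G.spectralMeasure q) := by
  constructor
  simp [spectralMeasure, ENNReal.inv_mul_cancel]

theorem integrable_spectralMeasure [Nonempty V] (f : ℝ → ℝ) :
    Integrable f (G.spectralMeasure q) := by
  refine Integrable.smul_measure (integrable_finsetSum_measure.2 fun k _ => integrable_dirac ?_) ?_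
  all_goals simp

theorem integral_spectralMeasure [Nonempty V] (f : ℝ → ℝ) :
    ∫ x, f x ∂(G.spectralMeasure q) = (Fintype.card V : ℝ)⁻¹ *
      ∑ k, f ((q : ℝ) ^ (-(1 / 2) : ℝ) * G.adjMatrix_isHermitian.eigenvalues k) := by
  rw [spectralMeasure, integral_smul_measure, integral_finsetSum_measure]
  · simp
  · exact fun k _ => integrable_dirac (by simp)

theorem integral_eval_spectralMeasure [Nonempty V] (P : ℝ[X]) :
    ∫ x, P.eval x ∂(G.spectralMeasure q) = (Fintype.card V : ℝ)⁻¹ *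
      trace (aeval ((q : ℝ) ^ (-(1 / 2) : ℝ) • G.adjMatrix) P) := by
  rw [integral_spectralMeasure]
  -- The scaling is absorbed into the polynomial, so only the eigenvalues of the unscaled matrix
  -- occur.
  have h := G.adjMatrix_isHermitian.trace_aeval (P.comp (C ((q : ℝ) ^ (-(1 / 2) : ℝ)) * X))
  simp only [eval_comp, eval_mul, eval_C, eval_X, aeval_comp, map_mul, aeval_C, aeval_X] at h
  rw [← h, Algebra.smul_def]

/-- The normalized number of closed non-backtracking walks as a spectral integral. -/
theorem IsRegularOfDegree.integral_chebyshev_spectralMeasure [Nonempty V] {G : DartGraph V D}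
    {q : ℕ} (hG : G.IsRegularOfDegree (q + 1)) (hq : q ≠ 0) (n : ℕ) :
    (q : ℝ) ^ (-((n + 1 : ℕ) : ℝ) / 2) *
        ((G.closedNBWalkCount (n + 1) : ℝ) / (Fintype.card V : ℝ)) =
      ∫ x, (Chebyshev.S ℝ ((n : ℤ) + 1)).eval x ∂(G.spectralMeasure q) -
        (q : ℝ)⁻¹ * ∫ x, (Chebyshev.S ℝ ((n : ℤ) - 1)).eval x ∂(G.spectralMeasure q) := by
  classical
  have := hG.finite_darts
  have := Fintype.ofFinite D
  have hq0 : (0 : ℝ) ≤ q := q.cast_nonneg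
  have hs : ((q : ℝ) ^ (-(1 / 2) : ℝ)) ^ 2 = (q : ℝ)⁻¹ := by
    rw [← Real.rpow_mul_natCast hq0, ← Real.rpow_neg_one]
    norm_num
  have hp : (q : ℝ) ^ (-((n + 1 : ℕ) : ℝ) / 2) = ((q : ℝ) ^ (-(1 / 2) : ℝ)) ^ (n + 1) := by
    rw [← Real.rpow_mul_natCast hq0]
    congr 1
    ring
  have h := congrArg trace (hG.pow_smul_nbWalkMatrix hq hs n)
  rw [Matrix.trace_smul, Matrix.trace_sub, Matrix.trace_smul, smul_eq_mul, smul_eq_mul,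
    ← closedNBWalkCount_succ_eq_trace_nbWalkMatrix] at h
  rw [integral_eval_spectralMeasure, integral_eval_spectralMeasure, hp]
  linear_combination (Fintype.card V : ℝ)⁻¹ * h

end Spectral

end DartGraph

/-! ### The semicircle distribution -/

section Semicircle

open Polynomial

/-- The density of the semicircle distribution. -/
noncomputable def semicircleDensity (x : ℝ) : ℝ := 1 / (2 * Real.pi) * √(4 - x ^ 2)

theorem semicircleDensity_nonneg (x : ℝ) : 0 ≤ semicircleDensity x := by
  unfold semicircleDensity
  positivity

theorem continuous_semicircleDensity : Continuous semicircleDensity := by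
  unfold semicircleDensity
  fun_prop

theorem semicircle_eq : semicircle = (volume.restrict (Set.Icc (-2) 2)).withDensity
    fun x => ENNReal.ofReal (semicircleDensity x) := rfl

theorem integral_semicircle (f : ℝ → ℝ) :
    ∫ x, f x ∂semicircle = ∫ x in (-2 : ℝ)..2, semicircleDensity x * f x := by
  rw [semicircle_eq, integral_withDensity_eq_integral_toReal_smul
    (by exact (continuous_semicircleDensity.measurable).ennreal_ofReal) (by simp),
    intervalIntegral.integral_of_le (by norm_num), integral_Icc_eq_integral_Ioc]
  simp only [ENNReal.toReal_ofReal (semicircleDensity_nonneg _), smul_eq_mul]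

theorem integral_semicircle_eq_integral_sin_sq {f : ℝ → ℝ} (hf : Continuous f) :
    ∫ x, f x ∂semicircle =
      2 / Real.pi * ∫ θ in 0..Real.pi, Real.sin θ * (f (2 * Real.cos θ) * Real.sin θ) := by
  have h := intervalIntegral.integral_comp_mul_deriv (a := 0) (b := Real.pi)
    (f := fun θ => 2 * Real.cos θ) (f' := fun θ => 2 * -Real.sin θ)
    (g := fun x => semicircleDensity x * f x)
    (fun θ _ => (Real.hasDerivAt_cos θ).const_mul 2) (by fun_prop)
    (continuous_semicircleDensity.mul hf)
  rw [Real.cos_zero, Real.cos_pi, mul_one, mul_neg_one, intervalIntegral.integral_symm (-2) 2] at h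
  have h' := neg_eq_iff_eq_neg.2 h
  rw [integral_semicircle, ← h', ← intervalIntegral.integral_neg,
    ← intervalIntegral.integral_const_mul]
  refine intervalIntegral.integral_congr fun θ hθ => ?_
  rw [Set.uIcc_of_le Real.pi_pos.le] at hθ
  have hs : √(4 - (2 * Real.cos θ) ^ 2) = 2 * Real.sin θ := by
    rw [show 4 - (2 * Real.cos θ) ^ 2 = (2 * Real.sin θ) ^ 2 by
      linear_combination (-4) * Real.sin_sq_add_cos_sq θ]
    exact Real.sqrt_sq (mul_nonneg zero_le_two (Real.sin_nonneg_of_mem_Icc hθ))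
  simp only [Function.comp, semicircleDensity, hs]
  field_simp

theorem integral_cos_int_mul {k : ℤ} (hk : k ≠ 0) :
    ∫ θ in 0..Real.pi, Real.cos (k * θ) = 0 := by
  rw [intervalIntegral.integral_comp_mul_left _ (Int.cast_ne_zero.2 hk), integral_cos]
  simp [Real.sin_int_mul_pi]

/-- With x = 2 cos θ the integrand is sin θ · sin((r+1)θ), a difference of cosines. The case r = 0
yields the total mass, r ≥ 1 the orthogonality to constants. -/
theorem integral_chebyshev_semicircle_eq (r : ℤ) :
    ∫ x, (Chebyshev.S ℝ r).eval x ∂semicircle = 1 / Real.pi *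
      ((∫ θ in 0..Real.pi, Real.cos (r * θ)) -
        ∫ θ in 0..Real.pi, Real.cos ((r + 2 : ℤ) * θ)) := by
  rw [integral_semicircle_eq_integral_sin_sq (Chebyshev.S ℝ r).continuous,
    ← intervalIntegral.integral_sub (Continuous.intervalIntegrable (by fun_prop) _ _)
      (Continuous.intervalIntegrable (by fun_prop) _ _), ← intervalIntegral.integral_const_mul,
    ← intervalIntegral.integral_const_mul]
  congr 1
  funext θ
  rw [Chebyshev.S_two_mul_real_cos]
  have h1 : (r : ℝ) * θ = (r + 1) * θ - θ := by ring
  have h2 : ((r + 2 : ℤ) : ℝ) * θ = (r + 1) * θ + θ := by push_cast; ring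
  rw [h1, h2, Real.cos_sub, Real.cos_add]
  ring

theorem integral_chebyshev_semicircle {r : ℕ} (hr : 1 ≤ r) :
    ∫ x, (Chebyshev.S ℝ r).eval x ∂semicircle = 0 := by
  rw [integral_chebyshev_semicircle_eq, integral_cos_int_mul (by omega),
    integral_cos_int_mul (by omega)]
  simp

instance : IsFiniteMeasure semicircle := by
  rw [semicircle_eq]
  exact isFiniteMeasure_withDensity_ofReal
    (continuous_semicircleDensity.integrableOn_Icc).hasFiniteIntegral

instance : IsProbabilityMeasure semicircle := by
  have h := integral_chebyshev_semicircle_eq 0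
  rw [integral_cos_int_mul (k := 0 + 2) (by norm_num)] at h
  simp only [Chebyshev.S_zero, eval_one, integral_const, smul_eq_mul, mul_one] at h
  rw [isProbabilityMeasure_iff_real, h]
  rw [Int.cast_zero]
  simp [Real.pi_ne_zero]

theorem ae_semicircle_mem_Icc : ∀ᵐ x ∂semicircle, x ∈ Set.Icc (-2 : ℝ) 2 :=
  (withDensity_absolutelyContinuous _ _).ae_le (ae_restrict_mem measurableSet_Icc)

theorem semicircle_absolutelyContinuous : semicircle ≪ volume :=
  (withDensity_absolutelyContinuous _ _).trans Measure.restrict_le_self.absolutelyContinuous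

instance : NullSingletonClass semicircle :=
  ⟨fun x => semicircle_absolutelyContinuous (by simp)⟩

/-- Strict growth of the distribution function on [-2, 2], needed for quantiles to converge at every
level. -/
theorem semicircle_Ioc_pos {a b : ℝ} (hab : a < b) (ha : a < 2) (hb : -2 < b) :
    0 < semicircle (Set.Ioc a b) := by
  have hs : (0 : ENNReal) < volume (Set.Ioo (max a (-2)) (min b 2)) := by
    rw [Real.volume_Ioo, ENNReal.ofReal_pos, sub_pos]
    exact max_lt (lt_min hab ha) (lt_min hb (by norm_num))
  refine lt_of_lt_of_le ?_ (measure_mono (s := Set.Ioo (max a (-2)) (min b 2)) ?_)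
  · rw [semicircle_eq, withDensity_apply _ measurableSet_Ioo,
      Measure.restrict_restrict measurableSet_Ioo, Set.inter_eq_left.2, pos_iff_ne_zero, Ne,
      lintegral_eq_zero_iff (continuous_semicircleDensity.measurable.ennreal_ofReal)]
    · intro h
      have h' : ∀ᵐ x ∂(volume.restrict (Set.Ioo (max a (-2)) (min b 2))), False := by
        filter_upwards [h, ae_restrict_mem measurableSet_Ioo] with x hx hx'
        have h2 : -2 < x := (le_max_right _ _).trans_lt hx'.1
        have h3 : x < 2 := hx'.2.trans_le (min_le_right _ _)
        have : 0 < semicircleDensity x := by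
          have : 0 < 4 - x ^ 2 := by nlinarith
          unfold semicircleDensity
          positivity
        simp only [Pi.zero_apply, ENNReal.ofReal_eq_zero] at hx
        linarith
      rw [ae_iff] at h'
      simp at h'
      simp [h'] at hs
    · exact fun x hx => ⟨(le_max_right _ _).trans hx.1.le, hx.2.le.trans (min_le_right _ _)⟩
  · exact fun x hx => ⟨(le_max_left _ _).trans_lt hx.1, hx.2.le.trans (min_le_left _ _)⟩

theorem integrable_semicircle_of_continuous {f : ℝ → ℝ} (hf : Continuous f) :
    Integrable f semicircle := by
  obtain ⟨C, hC⟩ := (isCompact_Icc (a := (-2 : ℝ)) (b := 2)).exists_bound_of_continuousOn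
    hf.continuousOn
  refine Integrable.of_bound hf.aestronglyMeasurable C ?_
  filter_upwards [ae_semicircle_mem_Icc] with x hx using hC x hx

theorem memWassersteinSpace_semicircle {p : ℝ} (hp : 1 ≤ p) :
    MemWassersteinSpace p semicircle :=
  ⟨inferInstance, integrable_semicircle_of_continuous
    (continuous_abs.rpow_const fun _ => Or.inr (by linarith))⟩

end Semicircle

/-! ### Moments tested on Chebyshev polynomials -/

section Moments

open Polynomial

/-- Convergence of all moments to those of the semicircle distribution may be tested on Chebyshev
polynomials. -/
theorem tendsto_integral_semicircle_iff {μ : ℕ → Measure ℝ} [∀ n, IsProbabilityMeasure (μ n)]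
    (hμ : ∀ n (P : ℝ[X]), Integrable (fun x => P.eval x) (μ n)) :
    (∀ P : ℝ[X], Tendsto (fun n => ∫ x, P.eval x ∂(μ n)) atTop
      (𝓝 (∫ x, P.eval x ∂semicircle))) ↔
    ∀ r : ℕ, 1 ≤ r →
      Tendsto (fun n => ∫ x, (Chebyshev.S ℝ r).eval x ∂(μ n)) atTop (𝓝 0) := by
  refine ⟨fun h r hr => integral_chebyshev_semicircle hr ▸ h _, fun h P => ?_⟩
  have hs (P : ℝ[X]) : Integrable (fun x => P.eval x) semicircle :=
    integrable_semicircle_of_continuous P.continuous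
  let M : Submodule ℝ ℝ[X] :=
    { carrier := {P | Tendsto (fun n => ∫ x, P.eval x ∂(μ n)) atTop
        (𝓝 (∫ x, P.eval x ∂semicircle))}
      add_mem' := fun {P Q} hP hQ => by
        simp only [Set.mem_ofPred_eq, eval_add, integral_add (hμ _ P) (hμ _ Q),
          integral_add (hs P) (hs Q)] at hP hQ ⊢
        exact hP.add hQ
      zero_mem' := by simp
      smul_mem' := fun c P hP => by
        simp only [Set.mem_ofPred_eq, eval_smul, integral_smul] at hP ⊢
        exact hP.const_smul c }
  have hS : ∀ r : ℕ, Chebyshev.S ℝ r ∈ M := fun r => by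
    rcases Nat.eq_zero_or_pos r with rfl | hr
    · change Tendsto _ _ _
      simp
    · change Tendsto _ _ _
      rw [integral_chebyshev_semicircle hr]
      exact h r hr
  -- The recurrence X S_r = S_(r+1) + S_(r-1), with S_(-1) = 0, makes the span stable under X; it
  -- contains S_0 = 1, hence all powers of X.
  have hX : ∀ P ∈ Submodule.span ℝ (Set.range fun r : ℕ => Chebyshev.S ℝ (r : ℤ)),
      X * P ∈ Submodule.span ℝ (Set.range fun r : ℕ => Chebyshev.S ℝ (r : ℤ)) := by
    intro P hP
    induction hP using Submodule.span_induction with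
    | mem P hP =>
      obtain ⟨r, rfl⟩ := hP
      have hXr : X * Chebyshev.S ℝ (r : ℤ) =
          Chebyshev.S ℝ ((r + 1 : ℕ) : ℤ) + Chebyshev.S ℝ ((r : ℤ) - 1) := by
        push_cast
        rw [Chebyshev.S_add_one, sub_add_cancel]
      simp only [hXr]
      refine add_mem (Submodule.subset_span ⟨_, rfl⟩) ?_
      rcases r with _ | r
      · simp
      · exact Submodule.subset_span ⟨r, by simp⟩
    | zero => simp
    | add P Q _ _ hP hQ => rw [mul_add]; exact add_mem hP hQ
    | smul c P _ hP => rw [mul_smul_comm]; exact Submodule.smul_mem _ c hP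
  have hpow : ∀ k : ℕ,
      (X : ℝ[X]) ^ k ∈ Submodule.span ℝ (Set.range fun r : ℕ => Chebyshev.S ℝ (r : ℤ)) := by
    intro k
    induction k with
    | zero => exact Submodule.subset_span ⟨0, by simp⟩
    | succ k ih => rw [pow_succ']; exact hX _ ih
  have hle : Submodule.span ℝ (Set.range fun r : ℕ => Chebyshev.S ℝ (r : ℤ)) ≤ M :=
    Submodule.span_le.2 (by rintro _ ⟨r, rfl⟩; exact hS r)
  change P ∈ M
  rw [P.as_sum_range_C_mul_X_pow]
  refine Submodule.sum_mem _ fun k _ => ?_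
  rw [← smul_eq_C_mul]
  exact M.smul_mem _ (hle (hpow k))

end Moments

/-! ### Moments, closed walks and circuits along the sequence -/

namespace DartGraph

open Polynomial

variable {V D : ℕ → Type*} [∀ n, Fintype (V n)] {G : ∀ n, DartGraph (V n) (D n)} {q : ℕ → ℕ}

theorem tendsto_inv_degree (hq : Tendsto q atTop atTop) :
    Tendsto (fun n => (q n : ℝ)⁻¹) atTop (𝓝 0) :=
  tendsto_inv_atTop_zero.comp (tendsto_natCast_atTop_atTop.comp hq)

section

variable [∀ n, DecidableEq (V n)] [∀ n, Nonempty (V n)]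

theorem tendsto_closedNBWalkCount_of_tendsto_chebyshev (hq : ∀ n, 1 ≤ q n)
    (hG : ∀ n, (G n).IsRegularOfDegree (q n + 1))
    (h : ∀ r : ℕ, 1 ≤ r → Tendsto
      (fun n => ∫ x, (Chebyshev.S ℝ r).eval x ∂((G n).spectralMeasure (q n))) atTop (𝓝 0)) :
    Tendsto q atTop atTop ∧ ∀ r : ℕ, 1 ≤ r →
      Tendsto (fun n => (q n : ℝ) ^ (-(r : ℝ) / 2) *
        (((G n).closedNBWalkCount r : ℝ) / (Fintype.card (V n) : ℝ))) atTop (𝓝 0) := by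
  have hq0 : ∀ n, q n ≠ 0 := fun n => by have := hq n; omega
  -- For r = 2 the lower polynomial is S_0 = 1, so nonnegativity of f_2 gives q^(-1) ≤ ∫ S_2 dμ.
  have hinv : Tendsto (fun n => (q n : ℝ)⁻¹) atTop (𝓝 0) := by
    refine squeeze_zero (fun n => by positivity) (fun n => ?_) (h 2 (by norm_num))
    have h2 := (hG n).integral_chebyshev_spectralMeasure (hq0 n) 1
    simp only [Nat.cast_one, sub_self, Chebyshev.S_zero, eval_one, integral_const, probReal_univ,
      smul_eq_mul, mul_one, one_add_one_eq_two] at h2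
    rw [Nat.cast_ofNat, ← sub_nonneg, ← h2]
    positivity
  have hqt : Tendsto q atTop atTop := by
    have h1 : Tendsto (fun n => (q n : ℝ)⁻¹) atTop (𝓝[>] 0) :=
      tendsto_nhdsWithin_iff.2 ⟨hinv, Eventually.of_forall fun n => by
        have := Nat.pos_of_ne_zero (hq0 n)
        simpa using this⟩
    have h2 := tendsto_inv_nhdsGT_zero.comp h1
    simp only [Function.comp_def, _root_.inv_inv] at h2
    exact tendsto_natCast_atTop_iff.1 h2
  refine ⟨hqt, fun r hr => ?_⟩
  obtain ⟨r, rfl⟩ := Nat.exists_eq_add_of_le' hr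
  simp only [(hG _).integral_chebyshev_spectralMeasure (hq0 _)]
  have hA := h (r + 1) hr
  obtain ⟨c, hB⟩ : ∃ c, Tendsto (fun n =>
      ∫ x, (Chebyshev.S ℝ ((r : ℤ) - 1)).eval x ∂((G n).spectralMeasure (q n))) atTop (𝓝 c) := by
    rcases r with _ | _ | r
    · exact ⟨0, by simp⟩
    · exact ⟨1, by simp⟩
    · refine ⟨0, ?_⟩
      have := h (r + 1) (by omega)
      convert! this using 7
      push_cast
      ring
  have := hA.sub (hinv.mul hB)
  push_cast at this
  simpa using this

theorem tendsto_chebyshev_of_tendsto_closedNBWalkCount (hq : ∀ n, 1 ≤ q n)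
    (hG : ∀ n, (G n).IsRegularOfDegree (q n + 1)) (hqt : Tendsto q atTop atTop)
    (h : ∀ r : ℕ, 1 ≤ r → Tendsto (fun n => (q n : ℝ) ^ (-(r : ℝ) / 2) *
        (((G n).closedNBWalkCount r : ℝ) / (Fintype.card (V n) : ℝ))) atTop (𝓝 0))
    (r : ℕ) (hr : 1 ≤ r) : Tendsto
      (fun n => ∫ x, (Chebyshev.S ℝ r).eval x ∂((G n).spectralMeasure (q n))) atTop (𝓝 0) := by
  have hq0 : ∀ n, q n ≠ 0 := fun n => by have := hq n; omega
  -- Any finite limit c of the lower integral suffices, because the factor q^(-1) kills it; c = 1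
  -- occurs for S_0.
  have key (r : ℕ) (c : ℝ) (hc : Tendsto (fun n =>
      ∫ x, (Chebyshev.S ℝ ((r : ℤ) - 1)).eval x ∂((G n).spectralMeasure (q n))) atTop (𝓝 c)) :
      Tendsto (fun n => ∫ x, (Chebyshev.S ℝ ((r + 1 : ℕ) : ℤ)).eval x
        ∂((G n).spectralMeasure (q n))) atTop (𝓝 0) := by
    have h1 := (h (r + 1) (by omega)).add ((tendsto_inv_degree hqt).mul hc)
    simp only [(hG _).integral_chebyshev_spectralMeasure (hq0 _), sub_add_cancel] at h1
    simpa using h1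
  obtain ⟨r, rfl⟩ := Nat.exists_eq_add_of_le' hr
  induction r using Nat.twoStepInduction with
  | zero => exact key 0 0 (by simp)
  | one => exact key 1 1 (by simp)
  | more r ih _ =>
    refine key (r + 2) 0 ?_
    convert! ih (by omega) using 7
    push_cast
    ring

end

theorem circuitCount_le_closedNBWalkCount {V D : Type*} [Finite V] (G : DartGraph V D) {k : ℕ}
    (hG : G.IsRegularOfDegree (k + 1)) {r : ℕ} (hr : 1 ≤ r) :
    G.circuitCount r ≤ G.closedNBWalkCount r := by
  obtain ⟨r, rfl⟩ := Nat.exists_eq_add_of_le' hr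
  have := hG.finite_darts
  have : Finite (G.Walk (r + 1)) := Finite.of_equiv _ (G.walkEquiv r).symm
  exact Nat.card_le_card_of_injective _
    (Subtype.impEmbedding (fun w : G.Walk (r + 1) => w.IsCircuit)
      (fun w => w.IsClosed ∧ w.IsNonBacktracking) fun _ hw => ⟨hw.1, hw.2.1⟩).injective

theorem tendsto_circuitCount_of_tendsto_closedNBWalkCount
    (hG : ∀ n, (G n).IsRegularOfDegree (q n + 1)) {r : ℕ} (hr : 1 ≤ r)
    (h : Tendsto (fun n => (q n : ℝ) ^ (-(r : ℝ) / 2) *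
      (((G n).closedNBWalkCount r : ℝ) / (Fintype.card (V n) : ℝ))) atTop (𝓝 0)) :
    Tendsto (fun n => (q n : ℝ) ^ (-(r : ℝ) / 2) *
      (((G n).circuitCount r : ℝ) / (Fintype.card (V n) : ℝ))) atTop (𝓝 0) := by
  refine squeeze_zero (fun n => by positivity) (fun n => ?_) h
  have := circuitCount_le_closedNBWalkCount (G n) (hG n) hr
  gcongr

theorem tendsto_closedNBWalkCount_of_tendsto_circuitCount (hq : ∀ n, 1 ≤ q n)
    (hG : ∀ n, (G n).IsRegularOfDegree (q n + 1))
    (h : ∀ r : ℕ, 1 ≤ r → Tendsto (fun n => (q n : ℝ) ^ (-(r : ℝ) / 2) *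
      (((G n).circuitCount r : ℝ) / (Fintype.card (V n) : ℝ))) atTop (𝓝 0))
    (r : ℕ) (hr : 1 ≤ r) : Tendsto (fun n => (q n : ℝ) ^ (-(r : ℝ) / 2) *
      (((G n).closedNBWalkCount r : ℝ) / (Fintype.card (V n) : ℝ))) atTop (𝓝 0) := by
  classical
  have := fun n => (hG n).finite_darts
  have := fun n => Fintype.ofFinite (D n)
  obtain ⟨r, rfl⟩ := Nat.exists_eq_add_of_le' hr
  induction r using Nat.twoStepInduction with
  | zero => simpa only [zero_add, closedNBWalkCount_one] using h 1 le_rfl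
  | one => simpa only [one_add_one_eq_two, closedNBWalkCount_two] using h 2 (by norm_num)
  | more r ih _ =>
    have h1 := (h (r + 3) (by omega)).add (ih (by omega))
    rw [add_zero] at h1
    refine squeeze_zero (fun n => by positivity) (fun n => ?_) h1
    have hq0 : (0 : ℝ) < q n := by exact_mod_cast hq n
    have hp : (q n : ℝ) ^ (-((r + 1 : ℕ) : ℝ) / 2) =
        (q n : ℝ) ^ (-((r + 3 : ℕ) : ℝ) / 2) * q n := by
      rw [← Real.rpow_add_one hq0.ne']
      congr 1
      push_cast
      ring
    -- The term -c_(r+1) of the recurrence can be dropped, as only an upper bound is needed.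
    have h2 : ((G n).closedNBWalkCount (r + 3) : ℝ) ≤
        (G n).circuitCount (r + 3) + q n * (G n).closedNBWalkCount (r + 1) := by
      rw [(hG n).closedNBWalkCount_add_three]
      have : (0 : ℝ) ≤ (G n).circuitCount (r + 1) := Nat.cast_nonneg _
      linarith
    calc _ ≤ (q n : ℝ) ^ (-((r + 3 : ℕ) : ℝ) / 2) *
          (((G n).circuitCount (r + 3) + q n * (G n).closedNBWalkCount (r + 1)) /
            (Fintype.card (V n) : ℝ)) := by gcongr
      _ = _ := by
        rw [hp]
        ring

end DartGraph

/-! ### Quantile functions and the comonotone coupling -/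

section Quantile

open ProbabilityTheory Set

variable (μ ν : Measure ℝ) [IsProbabilityMeasure μ] [IsProbabilityMeasure ν]

theorem invDistribFun_eq_sInf_cdf (x : ℝ) : invDistribFun μ x = sInf {y | x ≤ cdf μ y} := by
  simp only [invDistribFun, ← ofReal_cdf, ENNReal.ofReal_le_ofReal_iff (cdf_nonneg μ _)]

/-- The Galois connection between a distribution function and its generalized inverse. -/
theorem invDistribFun_le_iff {x : ℝ} (hx : x ∈ Ioo (0 : ℝ) 1) (t : ℝ) :
    invDistribFun μ x ≤ t ↔ x ≤ cdf μ t := by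
  rw [invDistribFun_eq_sInf_cdf]
  have hne : {y | x ≤ cdf μ y}.Nonempty :=
    (((tendsto_cdf_atTop μ).eventually_const_lt hx.2).exists).imp fun _ h => h.le
  have hbdd : BddBelow {y | x ≤ cdf μ y} := by
    obtain ⟨b, hb⟩ := ((tendsto_cdf_atBot μ).eventually_lt_const hx.1).exists
    exact ⟨b, fun y hy => le_of_not_gt fun hlt =>
      (hb.trans_le hy).not_ge (monotone_cdf μ hlt.le)⟩
  refine ⟨fun h => ?_, fun h => csInf_le hbdd h⟩
  -- The bound holds to the right of t and passes to t by right continuity.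
  have hlt : ∀ z ∈ Ioi t, x ≤ cdf μ z := fun z hz => by
    obtain ⟨y, hy, hyz⟩ := exists_lt_of_csInf_lt hne (h.trans_lt hz)
    exact hy.trans (monotone_cdf μ hyz.le)
  have hc : Tendsto (cdf μ) (𝓝[>] t) (𝓝 (cdf μ t)) :=
    ((cdf μ).right_continuous t).mono Ioi_subset_Ici_self
  exact ge_of_tendsto hc (eventually_nhdsWithin_of_forall hlt)

theorem lt_invDistribFun_iff {x : ℝ} (hx : x ∈ Ioo (0 : ℝ) 1) (t : ℝ) :
    t < invDistribFun μ x ↔ cdf μ t < x := by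
  rw [← not_le, invDistribFun_le_iff μ hx, not_le]

/-- At the levels 0 and 1 the infimum may be a default value of `sInf` and the Galois connection is
unavailable; both are null. -/
theorem restrict_Icc_zero_one :
    (volume : Measure ℝ).restrict (Icc 0 1) = volume.restrict (Ioo 0 1) :=
  Measure.restrict_congr_set Ioo_ae_eq_Icc.symm

theorem aemeasurable_invDistribFun :
    AEMeasurable (invDistribFun μ) (volume.restrict (Icc 0 1)) := by
  rw [restrict_Icc_zero_one]
  refine aemeasurable_restrict_of_monotoneOn measurableSet_Ioo fun x hx y hy hxy => ?_
  rw [invDistribFun_le_iff μ hx]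
  exact hxy.trans ((invDistribFun_le_iff μ hy _).1 le_rfl)

/-- The generalized inverse distribution function pushes the uniform distribution to `μ`. -/
theorem map_invDistribFun :
    (volume.restrict (Icc (0 : ℝ) 1)).map (invDistribFun μ) = μ := by
  have hm := aemeasurable_invDistribFun μ
  refine Measure.ext_of_Iic _ _ fun t => ?_
  rw [Measure.map_apply_of_aemeasurable hm measurableSet_Iic, restrict_Icc_zero_one,
    Measure.restrict_apply' measurableSet_Ioo, ← ofReal_cdf]
  have hset : invDistribFun μ ⁻¹' Iic t ∩ Ioo 0 1 = Iic (cdf μ t) ∩ Ioo 0 1 := by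
    ext x
    exact and_congr_left fun hx => invDistribFun_le_iff μ hx t
  rw [hset]
  have h1 := cdf_le_one μ t
  refine le_antisymm ?_ ?_
  · refine (measure_mono (t := Ioc 0 (cdf μ t)) fun x hx => ⟨hx.2.1, hx.1⟩).trans ?_
    simp
  · refine le_trans ?_ (measure_mono (s := Ioo 0 (cdf μ t)) fun x hx =>
      ⟨hx.2.le, hx.1, hx.2.trans_le h1⟩)
    simp

theorem memLp_invDistribFun {p : ℝ} (hp : 1 ≤ p) (h : MemWassersteinSpace p μ) :
    MemLp (invDistribFun μ) (ENNReal.ofReal p) (volume.restrict (Icc 0 1)) := by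
  have hp0 : 0 < p := by linarith
  have hid : MemLp id (ENNReal.ofReal p) μ := by
    rw [← integrable_norm_rpow_iff (by fun_prop) (by simpa using hp0) ENNReal.ofReal_ne_top,
      ENNReal.toReal_ofReal hp0.le]
    exact h.2
  rw [← map_invDistribFun μ] at hid
  exact (memLp_map_measure_iff (by fun_prop) (aemeasurable_invDistribFun μ)).1 hid

/-- The comonotone coupling bounds the Wasserstein distance. -/
theorem wassersteinDist_le_eLpNorm {p : ℝ} (hp : 1 ≤ p) :
    wassersteinDist p μ ν ≤ eLpNorm (invDistribFun μ - invDistribFun ν) (ENNReal.ofReal p)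
      (volume.restrict (Icc 0 1)) := by
  have hp0 : 0 < p := by linarith
  have hμ := aemeasurable_invDistribFun μ
  have hν := aemeasurable_invDistribFun ν
  have hc : (volume.restrict (Icc (0 : ℝ) 1)).map
      (fun x => (invDistribFun μ x, invDistribFun ν x)) ∈ couplings μ ν := by
    constructor <;> rw [AEMeasurable.map_map_of_aemeasurable (by fun_prop) (hμ.prodMk hν)]
    · exact map_invDistribFun μ
    · exact map_invDistribFun ν
  refine (iInf₂_le _ hc).trans_eq ?_
  rw [lintegral_map' (by fun_prop) (hμ.prodMk hν),
    eLpNorm_eq_lintegral_rpow_enorm_toReal (by simpa using hp0) ENNReal.ofReal_ne_top,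
    ENNReal.toReal_ofReal hp0.le]
  simp only [Pi.sub_apply, Real.enorm_eq_ofReal_abs,
    ENNReal.ofReal_rpow_of_nonneg (abs_nonneg _) hp0.le]

end Quantile

theorem ConvergesInLpUnitInterval.convergesInWasserstein {p : ℝ} (hp : 1 ≤ p)
    {μ : ℕ → Measure ℝ} {ν : Measure ℝ} (hμ : ∀ n, MemWassersteinSpace p (μ n))
    (hν : MemWassersteinSpace p ν)
    (h : ConvergesInLpUnitInterval p (fun n => invDistribFun (μ n)) (invDistribFun ν)) :
    ConvergesInWasserstein p μ ν := by
  refine ⟨hμ, hν, tendsto_of_tendsto_of_tendsto_of_le_of_le tendsto_const_nhds h.2.2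
    (fun n => zero_le) fun n => ?_⟩
  have := (hμ n).1
  have := hν.1
  exact wassersteinDist_le_eLpNorm _ _ hp

/-! ### From Wasserstein convergence to moments -/

section WassersteinMoments

theorem exists_coupling_of_wassersteinDist_lt {p δ : ℝ} (hp : 0 < p) (hδ : 0 ≤ δ)
    {μ ν : Measure ℝ} (h : wassersteinDist p μ ν < ENNReal.ofReal δ) :
    ∃ γ ∈ couplings μ ν,
      ∫⁻ z : ℝ × ℝ, ENNReal.ofReal (|z.1 - z.2| ^ p) ∂γ < ENNReal.ofReal (δ ^ p) := by
  simp only [wassersteinDist, iInf_lt_iff] at h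
  obtain ⟨γ, hγ, h⟩ := h
  refine ⟨γ, hγ, ?_⟩
  rw [one_div, ENNReal.rpow_inv_lt_iff hp] at h
  rwa [← ENNReal.ofReal_rpow_of_nonneg hδ hp.le]

/-- With h = |x - y|, the mean value bound is k h (h+2)^(k-1), and h + 2 is at most 3 or 3h
according as h ≤ 1 or h ≥ 1. The remaining linear term is traded for ε plus a multiple of h^k, so
that only the k-th transport cost enters. -/
theorem abs_pow_sub_pow_le_of_abs_le_two {x y : ℝ} (hy : |y| ≤ 2) {k : ℕ} (hk : 1 ≤ k) {ε : ℝ}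
    (hε : 0 < ε) :
    |x ^ k - y ^ k| ≤ k * 3 ^ k * (ε + ((ε ^ (k - 1))⁻¹ + 1) * |x - y| ^ k) := by
  have hxy : |x| ≤ |x - y| + |y| := by simpa using abs_add_le (x - y) y
  set h := |x - y| with hh
  have h0 : 0 ≤ h := abs_nonneg _
  have hmax : max |x| |y| ≤ h + 2 := max_le (by linarith) (by linarith)
  have h1 : h * (h + 2) ^ (k - 1) ≤ 3 ^ k * (h + h ^ k) := by
    obtain ⟨m, rfl⟩ := Nat.exists_eq_add_of_le' hk
    rw [Nat.add_sub_cancel]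
    have h3 : (3 : ℝ) ^ m ≤ 3 ^ (m + 1) := pow_le_pow_right₀ (by norm_num) (by omega)
    rcases le_total h 1 with hle | hle
    · calc h * (h + 2) ^ m ≤ h * 3 ^ m := by gcongr; linarith
        _ ≤ 3 ^ (m + 1) * h := by rw [mul_comm]; gcongr
        _ ≤ _ := by gcongr; linarith [pow_nonneg h0 (m + 1)]
    · calc h * (h + 2) ^ m ≤ h * (3 * h) ^ m := by gcongr; linarith
        _ = 3 ^ m * h ^ (m + 1) := by rw [mul_pow]; ring
        _ ≤ _ := by gcongr; linarith
  have h2 : h ≤ ε + (ε ^ (k - 1))⁻¹ * h ^ k := by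
    rcases le_total h ε with hle | hle
    · have : 0 ≤ (ε ^ (k - 1))⁻¹ * h ^ k := by positivity
      linarith
    · obtain ⟨m, rfl⟩ := Nat.exists_eq_add_of_le' hk
      rw [Nat.add_sub_cancel]
      have : h ≤ (ε ^ m)⁻¹ * h ^ (m + 1) := by
        rw [inv_mul_eq_div, le_div_iff₀ (by positivity), pow_succ', mul_comm, mul_comm h]
        gcongr
      linarith
  calc |x ^ k - y ^ k| ≤ h * k * max |x| |y| ^ (k - 1) := abs_pow_sub_pow_le x y k
    _ ≤ h * k * (h + 2) ^ (k - 1) := by gcongr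
    _ = k * (h * (h + 2) ^ (k - 1)) := by ring
    _ ≤ k * (3 ^ k * (h + h ^ k)) := by gcongr
    _ ≤ k * (3 ^ k * ((ε + (ε ^ (k - 1))⁻¹ * h ^ k) + h ^ k)) := by gcongr
    _ = _ := by ring

theorem abs_integral_pow_sub_le {μ ν : Measure ℝ} [IsProbabilityMeasure μ]
    (hν : ∀ᵐ y ∂ν, |y| ≤ 2) {k : ℕ} (hk : 1 ≤ k)
    (hμk : Integrable (fun x => x ^ k) μ) (hνk : Integrable (fun x => x ^ k) ν)
    {γ : Measure (ℝ × ℝ)} (hγ : γ ∈ couplings μ ν) {ε η : ℝ} (hε : 0 < ε) (hη : 0 ≤ η)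
    (h : ∫⁻ z : ℝ × ℝ, ENNReal.ofReal (|z.1 - z.2| ^ k) ∂γ ≤ ENNReal.ofReal η) :
    |∫ x, x ^ k ∂μ - ∫ x, x ^ k ∂ν| ≤ k * 3 ^ k * (ε + ((ε ^ (k - 1))⁻¹ + 1) * η) := by
  obtain ⟨h1, h2⟩ := hγ
  have : IsProbabilityMeasure γ := by
    have h' : IsProbabilityMeasure (γ.map Prod.fst) := h1 ▸ inferInstance
    exact Measure.isProbabilityMeasure_of_map Prod.fst
  have hi : Integrable (fun z : ℝ × ℝ => |z.1 - z.2| ^ k) γ := by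
    refine ⟨by fun_prop, ?_⟩
    rw [hasFiniteIntegral_iff_ofReal (Eventually.of_forall fun _ => by positivity)]
    exact h.trans_lt ENNReal.ofReal_lt_top
  have hle : ∫ z, |z.1 - z.2| ^ k ∂γ ≤ η := by
    rw [← ofReal_integral_eq_lintegral_ofReal hi (Eventually.of_forall fun _ => by positivity)] at h
    exact (ENNReal.ofReal_le_ofReal_iff hη).1 h
  rw [← h1] at hμk ⊢
  rw [← h2] at hνk hν ⊢
  have hi1 : Integrable (fun z : ℝ × ℝ => z.1 ^ k) γ := hμk.comp_measurable measurable_fst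
  have hi2 : Integrable (fun z : ℝ × ℝ => z.2 ^ k) γ := hνk.comp_measurable measurable_snd
  rw [integral_map (by fun_prop) (by fun_prop), integral_map (by fun_prop) (by fun_prop),
    ← integral_sub hi1 hi2]
  have hν' : ∀ᵐ z ∂γ, |z.2| ≤ 2 := ae_of_ae_map (by fun_prop) hν
  refine abs_integral_le_integral_abs.trans ?_
  calc ∫ z, |z.1 ^ k - z.2 ^ k| ∂γ
      ≤ ∫ z, k * 3 ^ k * (ε + ((ε ^ (k - 1))⁻¹ + 1) * |z.1 - z.2| ^ k) ∂γ := by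
        refine integral_mono_ae (hi1.sub hi2).abs
          (((integrable_const _).add (hi.const_mul _)).const_mul _) ?_
        filter_upwards [hν'] with z hz using abs_pow_sub_pow_le_of_abs_le_two hz hk hε
    _ = k * 3 ^ k * (ε + ((ε ^ (k - 1))⁻¹ + 1) * ∫ z, |z.1 - z.2| ^ k ∂γ) := by
        rw [integral_const_mul, integral_add (integrable_const _) (hi.const_mul _),
          integral_const_mul]
        simp
    _ ≤ _ := by gcongr

theorem tendsto_integral_pow_of_tendsto_wassersteinDist {μ : ℕ → Measure ℝ} {ν : Measure ℝ}
    [∀ n, IsProbabilityMeasure (μ n)] (hν : ∀ᵐ y ∂ν, |y| ≤ 2) {k : ℕ} (hk : 1 ≤ k)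
    (hμk : ∀ n, Integrable (fun x => x ^ k) (μ n)) (hνk : Integrable (fun x => x ^ k) ν)
    (h : Tendsto (fun n => wassersteinDist k (μ n) ν) atTop (𝓝 0)) :
    Tendsto (fun n => ∫ x, x ^ k ∂(μ n)) atTop (𝓝 (∫ x, x ^ k ∂ν)) := by
  have hk0 : (0 : ℝ) < k := by exact_mod_cast hk
  rw [Metric.tendsto_atTop']
  intro ρ hρ
  obtain ⟨ε, hε, hερ⟩ : ∃ ε : ℝ, 0 < ε ∧ k * 3 ^ k * (ε + ε) < ρ := by
    refine ⟨ρ / (4 * (k * 3 ^ k)), by positivity, ?_⟩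
    field_simp
    norm_num
  set a : ℝ := (ε ^ (k - 1))⁻¹ + 1 with ha
  have ha0 : 0 < a := by positivity
  -- The cost ε / a makes the second term of the bound equal to ε; its k-th root is the matching
  -- distance.
  have hη : 0 < ε / a := by positivity
  have hδ : 0 < (ε / a) ^ (1 / (k : ℝ)) := by positivity
  obtain ⟨N, hN⟩ := eventually_atTop.1 (h.eventually_lt_const (ENNReal.ofReal_pos.2 hδ))
  refine ⟨N, fun n hn => ?_⟩
  obtain ⟨γ, hγ, hγ'⟩ := exists_coupling_of_wassersteinDist_lt hk0 hδ.le (hN n hn.le)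
  rw [← Real.rpow_mul hη.le, one_div, inv_mul_cancel₀ hk0.ne', Real.rpow_one] at hγ'
  simp only [Real.rpow_natCast] at hγ'
  have := abs_integral_pow_sub_le hν hk (hμk n) hνk hγ hε hη.le hγ'.le
  rw [← ha, mul_div_cancel₀ _ ha0.ne'] at this
  exact this.trans_lt hερ

end WassersteinMoments

/-! ### From moments to weak convergence and quantiles -/

section MethodOfMoments

open Polynomial ProbabilityTheory BoundedContinuousFunction

variable {μ : ℕ → Measure ℝ} {ν : Measure ℝ}

theorem Polynomial.exists_abs_eval_le_pow (P : ℝ[X]) :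
    ∃ C : ℝ, 0 ≤ C ∧ ∀ x : ℝ, 3 ≤ |x| → |P.eval x| ≤ C * (|x| / 3) ^ P.natDegree := by
  refine ⟨∑ i ∈ Finset.range (P.natDegree + 1), |P.coeff i| * 3 ^ i,
    Finset.sum_nonneg fun _ _ => by positivity, fun x hx => ?_⟩
  have h1 : 1 ≤ |x| / 3 := by rw [le_div_iff₀ (by norm_num)]; linarith
  rw [eval_eq_sum_range, Finset.sum_mul]
  refine (Finset.abs_sum_le_sum_abs _ _).trans (Finset.sum_le_sum fun i hi => ?_)
  rw [abs_mul, abs_pow, mul_assoc]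
  gcongr
  calc |x| ^ i = 3 ^ i * (|x| / 3) ^ i := by rw [← mul_pow]; congr 1; ring
    _ ≤ _ := by
      gcongr
      exact Finset.mem_range_succ_iff.1 hi

/-- Convergence of moments to those of a measure on `[-2, 2]` forces uniformly small tails. -/
theorem exists_eventually_integral_pow_lt [IsProbabilityMeasure ν] (hν : ∀ᵐ y ∂ν, |y| ≤ 2)
    (h : ∀ P : ℝ[X], Tendsto (fun n => ∫ x, P.eval x ∂(μ n)) atTop (𝓝 (∫ x, P.eval x ∂ν)))
    (d : ℕ) {δ : ℝ} (hδ : 0 < δ) : ∃ k, d ≤ k ∧ (∫ x, (|x| / 3) ^ (2 * k) ∂ν < δ) ∧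
      ∀ᶠ n in atTop, ∫ x, (|x| / 3) ^ (2 * k) ∂(μ n) < δ := by
  -- Here 4/9 = (2/3)²: on [-2, 2] the even power (|x|/3)^(2k) is at most (4/9)^k. Evenness also
  -- makes it a polynomial in x.
  obtain ⟨k, hdk, hk⟩ : ∃ k, d ≤ k ∧ (4 / 9 : ℝ) ^ k < δ := by
    obtain ⟨m, hm⟩ := exists_pow_lt_of_lt_one hδ (by norm_num : (4 / 9 : ℝ) < 1)
    exact ⟨max d m, le_max_left _ _,
      (pow_le_pow_of_le_one (by norm_num) (by norm_num) (le_max_right _ _)).trans_lt hm⟩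
  have hle : ∫ x, (|x| / 3) ^ (2 * k) ∂ν ≤ (4 / 9) ^ k := by
    have h1 : ∀ᵐ x ∂ν, ‖(|x| / 3) ^ (2 * k)‖ ≤ (4 / 9 : ℝ) ^ k := by
      filter_upwards [hν] with x hx
      rw [Real.norm_of_nonneg (by positivity), pow_mul]
      gcongr
      rw [div_pow]
      nlinarith [abs_nonneg x]
    simpa using (le_abs_self _).trans (norm_integral_le_of_norm_le_const h1)
  refine ⟨k, hdk, hle.trans_lt hk, ?_⟩
  have he : ∀ x : ℝ, ((C (1 / 3 : ℝ) * X) ^ (2 * k)).eval x = (|x| / 3) ^ (2 * k) := fun x => by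
    rw [eval_pow, eval_mul, eval_C, eval_X, pow_mul, pow_mul, div_pow, sq_abs]
    ring
  have ht := h ((C (1 / 3 : ℝ) * X) ^ (2 * k))
  simp only [he] at ht
  exact ht.eventually_lt_const (hle.trans_lt hk)

theorem integrable_abs_div_pow (hμ : ∀ P : ℝ[X], Integrable (fun x => P.eval x) ν) (k : ℕ) :
    Integrable (fun x => (|x| / 3) ^ k) ν := by
  refine (hμ ((C (1 / 3 : ℝ) * X) ^ k)).norm.congr (Eventually.of_forall fun x => ?_)
  simp only [eval_pow, eval_mul, eval_C, eval_X, norm_pow, norm_mul, Real.norm_eq_abs]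
  norm_num
  ring

/-- The method of moments for a limit supported on `[-2, 2]`. -/
theorem tendsto_integral_of_tendsto_moments [∀ n, IsProbabilityMeasure (μ n)]
    [IsProbabilityMeasure ν] (hν : ∀ᵐ y ∂ν, |y| ≤ 2)
    (hμi : ∀ n (P : ℝ[X]), Integrable (fun x => P.eval x) (μ n))
    (hνi : ∀ P : ℝ[X], Integrable (fun x => P.eval x) ν)
    (h : ∀ P : ℝ[X], Tendsto (fun n => ∫ x, P.eval x ∂(μ n)) atTop (𝓝 (∫ x, P.eval x ∂ν)))
    (f : ℝ →ᵇ ℝ) : Tendsto (fun n => ∫ x, f x ∂(μ n)) atTop (𝓝 (∫ x, f x ∂ν)) := by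
  rw [Metric.tendsto_atTop']
  intro ρ hρ
  set ε := ρ / 5 with hε
  have hε0 : 0 < ε := by positivity
  -- On [-3, 3] the error is ε; outside, f and P are both dominated by (|x|/3)^(2k). Each measure
  -- then costs 2ε and the convergence of ∫ P another ε, in total 5ε = ρ.
  obtain ⟨P, hP⟩ := exists_polynomial_near_of_continuousOn (-3) 3 f f.continuous.continuousOn ε hε0
  obtain ⟨C, hC0, hC⟩ := P.exists_abs_eval_le_pow
  set K := ‖f‖ + C + 1 with hK
  have hK0 : 0 < K := by positivity
  obtain ⟨k, hdk, hkν, hkμ⟩ := exists_eventually_integral_pow_lt hν h P.natDegree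
    (div_pos hε0 hK0)
  have hbound : ∀ x, |f x - P.eval x| ≤ ε + K * (|x| / 3) ^ (2 * k) := by
    intro x
    rcases le_total |x| 3 with hx | hx
    · have h1 := (hP x (abs_le.1 hx)).le
      rw [abs_sub_comm]
      have : 0 ≤ K * (|x| / 3) ^ (2 * k) := by positivity
      linarith
    · have h1 : 1 ≤ |x| / 3 := by rw [le_div_iff₀ (by norm_num)]; linarith
      have h2 : (|x| / 3) ^ P.natDegree ≤ (|x| / 3) ^ (2 * k) :=
        pow_le_pow_right₀ h1 (by omega)
      have h3 : 1 ≤ (|x| / 3) ^ (2 * k) := one_le_pow₀ h1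
      have h4 : |f x| ≤ ‖f‖ := f.norm_coe_le_norm x
      calc |f x - P.eval x| ≤ |f x| + |P.eval x| := abs_sub _ _
        _ ≤ ‖f‖ * (|x| / 3) ^ (2 * k) + C * (|x| / 3) ^ (2 * k) := by
          refine add_le_add (h4.trans (le_mul_of_one_le_right (norm_nonneg _) h3))
            ((hC x hx).trans (by gcongr))
        _ ≤ _ := by nlinarith
  have hint : ∀ (m : Measure ℝ) [IsProbabilityMeasure m],
      (∀ P : ℝ[X], Integrable (fun x => P.eval x) m) →
      ∫ x, (|x| / 3) ^ (2 * k) ∂m < ε / K →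
      |∫ x, f x ∂m - ∫ x, P.eval x ∂m| ≤ 2 * ε := by
    intro m _ hm hlt
    rw [← integral_sub (f.integrable m) (hm P)]
    refine abs_integral_le_integral_abs.trans ?_
    have hik := integrable_abs_div_pow hm (2 * k)
    calc ∫ x, |f x - P.eval x| ∂m ≤ ∫ x, (ε + K * (|x| / 3) ^ (2 * k)) ∂m :=
          integral_mono ((f.integrable m).sub (hm P)).abs
            ((integrable_const _).add (hik.const_mul _)) hbound
      _ = ε + K * ∫ x, (|x| / 3) ^ (2 * k) ∂m := by
          rw [integral_add (integrable_const _) (hik.const_mul _), integral_const_mul]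
          simp
      _ ≤ ε + K * (ε / K) := by gcongr
      _ = 2 * ε := by rw [mul_div_cancel₀ _ hK0.ne']; ring
  obtain ⟨N, hN⟩ := eventually_atTop.1
    (hkμ.and ((Metric.tendsto_nhds.1 (h P)) ε hε0))
  refine ⟨N, fun n hn => ?_⟩
  obtain ⟨h1, h2⟩ := hN n hn.le
  have h3 := hint (μ n) (hμi n) h1
  have h4 := hint ν hνi hkν
  rw [Real.dist_eq] at h2 ⊢
  rw [abs_le] at h3 h4
  rw [abs_lt] at h2 ⊢
  constructor <;> linarith

theorem tendsto_cdf_of_tendsto_integral [∀ n, IsProbabilityMeasure (μ n)]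
    [IsProbabilityMeasure ν] [NullSingletonClass ν]
    (h : ∀ f : ℝ →ᵇ ℝ, Tendsto (fun n => ∫ x, f x ∂(μ n)) atTop (𝓝 (∫ x, f x ∂ν))) (t : ℝ) :
    Tendsto (fun n => cdf (μ n) t) atTop (𝓝 (cdf ν t)) := by
  let μ' : ℕ → ProbabilityMeasure ℝ := fun n => ⟨μ n, inferInstance⟩
  let ν' : ProbabilityMeasure ℝ := ⟨ν, inferInstance⟩
  have hw : Tendsto μ' atTop (𝓝 ν') :=
    ProbabilityMeasure.tendsto_iff_forall_integral_tendsto.2 h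
  have := ProbabilityMeasure.tendsto_measure_of_null_frontier_of_tendsto' hw (E := Set.Iic t)
    (by rw [frontier_Iic]; exact measure_singleton (μ := ν) t)
  simp only [cdf_eq_real]
  exact (ENNReal.tendsto_toReal (measure_ne_top _ _)).comp this

/-- Lower bounds on quantiles translate directly through the Galois connection. Upper bounds need
strict inequality beyond the limit quantile, which excludes a flat piece of the limit distribution
function at height x. -/
theorem tendsto_invDistribFun_of_tendsto_cdf [∀ n, IsProbabilityMeasure (μ n)]
    [IsProbabilityMeasure ν] (h : ∀ t, Tendsto (fun n => cdf (μ n) t) atTop (𝓝 (cdf ν t)))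
    {x : ℝ} (hx : x ∈ Set.Ioo (0 : ℝ) 1)
    (hlt : ∀ t, invDistribFun ν x < t → x < cdf ν t) :
    Tendsto (fun n => invDistribFun (μ n) x) atTop (𝓝 (invDistribFun ν x)) := by
  refine tendsto_order.2 ⟨fun a ha => ?_, fun b hb => ?_⟩
  · rw [lt_invDistribFun_iff ν hx] at ha
    filter_upwards [(h a).eventually_lt_const ha] with n hn
    rwa [lt_invDistribFun_iff (μ n) hx]
  · obtain ⟨t, ht, htb⟩ := exists_between hb
    filter_upwards [(h t).eventually_const_lt (hlt t ht)] with n hn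
    exact ((invDistribFun_le_iff (μ n) hx t).2 hn.le).trans_lt htb

theorem cdf_semicircle_gt {x : ℝ} (hx : x ∈ Set.Ioo (0 : ℝ) 1) {t : ℝ}
    (ht : invDistribFun semicircle x < t) : x < cdf semicircle t := by
  set y := invDistribFun semicircle x with hy
  have hxy : x ≤ cdf semicircle y := (invDistribFun_le_iff semicircle hx y).1 le_rfl
  have hy2 : -2 ≤ y := by
    by_contra! hlt
    have h0 : semicircle (Set.Iic y) = 0 := by
      refine measure_eq_zero_iff_ae_notMem.2 ?_
      filter_upwards [ae_semicircle_mem_Icc] with z hz hzy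
      exact absurd (hz.1.trans hzy) (not_le.2 hlt)
    rw [cdf_eq_real, measureReal_def, h0] at hxy
    exact absurd hx.1 (not_lt.2 hxy)
  rcases lt_or_ge y 2 with hlt | hge
  · have hpos := semicircle_Ioc_pos ht hlt (hy2.trans_lt ht)
    have h1 := (cdf semicircle).measure_Ioc y t
    rw [measure_cdf] at h1
    rw [h1, ENNReal.ofReal_pos, sub_pos] at hpos
    exact hxy.trans_lt hpos
  · have h1 : semicircle (Set.Iic t) = 1 := by
      rw [prob_compl_eq_zero_iff measurableSet_Iic |>.symm]
      refine measure_eq_zero_iff_ae_notMem.2 ?_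
      filter_upwards [ae_semicircle_mem_Icc] with z hz hzt
      exact hzt (hz.2.trans (hge.trans ht.le))
    rw [cdf_eq_real, measureReal_def, h1]
    exact hx.2

/-- If |u - v| ≥ 5 then |u| ≥ 3, whence |u - v| ≤ |u| + 2 ≤ 6(|u|/3) with |u|/3 ≥ 1, and the
exponent may be raised from p to 2k. -/
theorem abs_rpow_le_min_add {p : ℝ} (hp : 1 ≤ p) {k : ℕ} (hk : p ≤ (2 * k : ℕ)) {u v : ℝ}
    (hv : |v| ≤ 2) :
    |u - v| ^ p ≤ min |u - v| 5 ^ p + 6 ^ p * (|u| / 3) ^ (2 * k) := by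
  have h0 : (0 : ℝ) ≤ 6 ^ p * (|u| / 3) ^ (2 * k) := by positivity
  rcases le_total |u - v| 5 with h | h
  · rw [min_eq_left h]
    linarith
  · have h1 : |u - v| ≤ |u| + |v| := abs_sub _ _
    have h2 : 1 ≤ |u| / 3 := by rw [le_div_iff₀ (by norm_num)]; linarith
    have h3 : |u - v| ^ p ≤ 6 ^ p * (|u| / 3) ^ (2 * k) := by
      calc |u - v| ^ p ≤ (6 * (|u| / 3)) ^ p := by
            gcongr
            linarith
        _ = 6 ^ p * (|u| / 3) ^ p := Real.mul_rpow (by norm_num) (by positivity)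
        _ ≤ _ := by
            rw [← Real.rpow_natCast]
            gcongr
    have : 0 ≤ min |u - v| 5 ^ p := by positivity
    linarith

/-- Convergence of quantile functions in `L^p` from almost everywhere convergence and convergence
of moments. -/
theorem tendsto_eLpNorm_invDistribFun [∀ n, IsProbabilityMeasure (μ n)]
    [IsProbabilityMeasure ν] (hν : ∀ᵐ y ∂ν, |y| ≤ 2)
    (hμi : ∀ n (P : ℝ[X]), Integrable (fun x => P.eval x) (μ n))
    (h : ∀ P : ℝ[X], Tendsto (fun n => ∫ x, P.eval x ∂(μ n)) atTop (𝓝 (∫ x, P.eval x ∂ν)))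
    (hlim : ∀ x ∈ Set.Ioo (0 : ℝ) 1,
      Tendsto (fun n => invDistribFun (μ n) x) atTop (𝓝 (invDistribFun ν x)))
    {p : ℝ} (hp : 1 ≤ p)
    (hμp : ∀ n, MemLp (invDistribFun (μ n)) (ENNReal.ofReal p) (volume.restrict (Set.Icc 0 1)))
    (hνp : MemLp (invDistribFun ν) (ENNReal.ofReal p) (volume.restrict (Set.Icc 0 1))) :
    Tendsto (fun n => eLpNorm (invDistribFun (μ n) - invDistribFun ν) (ENNReal.ofReal p)
      (volume.restrict (Set.Icc 0 1))) atTop (𝓝 0) := by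
  have hp0 : 0 < p := by linarith
  set l : Measure ℝ := volume.restrict (Set.Icc 0 1) with hl
  have hlp : IsFiniteMeasure l := by rw [hl]; infer_instance
  set u := fun n => invDistribFun (μ n) with hu
  set v := invDistribFun ν with hv
  have hvb : ∀ᵐ x ∂l, |v x| ≤ 2 := by
    refine ae_of_ae_map (aemeasurable_invDistribFun ν) (p := fun y => |y| ≤ 2) ?_
    rw [map_invDistribFun]
    exact hν
  have hmeas : ∀ n, AEMeasurable (fun x => |u n x - v x|) l := fun n =>
    ((aemeasurable_invDistribFun (μ n)).sub (aemeasurable_invDistribFun ν)).abs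
  -- The truncated cost is bounded, so pointwise convergence suffices; the excess is a tail moment
  -- of u, which is one of `μ n` by the change of variables `map_invDistribFun`.
  have hmin : Tendsto (fun n => ∫ x, min |u n x - v x| 5 ^ p ∂l) atTop (𝓝 0) := by
    rw [show (0 : ℝ) = ∫ _, 0 ∂l by simp]
    refine tendsto_integral_of_dominated_convergence (fun _ => 5 ^ p)
      (fun n => (((hmeas n).min aemeasurable_const).pow_const p).aestronglyMeasurable)
      (integrable_const _) (fun n => Eventually.of_forall fun x => ?_) ?_
    · rw [Real.norm_of_nonneg (by positivity)]
      gcongr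
      exact min_le_right _ _
    · rw [hl, restrict_Icc_zero_one]
      filter_upwards [ae_restrict_mem measurableSet_Ioo] with x hx
      have h1 : Tendsto (fun n => |u n x - v x|) atTop (𝓝 0) := by
        simpa using ((hlim x hx).sub_const (v x)).abs
      have h2 := (h1.min (tendsto_const_nhds (x := (5 : ℝ)))).rpow_const (p := p)
        (Or.inr hp0.le)
      simpa [hp0.ne'] using h2
  have hint : Tendsto (fun n => ∫ x, |u n x - v x| ^ p ∂l) atTop (𝓝 0) := by
    rw [Metric.tendsto_atTop']
    intro ρ hρ
    have h6 : (0 : ℝ) < 6 ^ p := by positivity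
    obtain ⟨k, hk, -, hkμ⟩ := exists_eventually_integral_pow_lt hν h ⌈p⌉₊
      (div_pos (half_pos hρ) h6)
    have hpk : p ≤ (2 * k : ℕ) := (Nat.le_ceil p).trans (by exact_mod_cast by omega)
    obtain ⟨N, hN⟩ := eventually_atTop.1 (hkμ.and (hmin.eventually_lt_const (half_pos hρ)))
    refine ⟨N, fun n hn => ?_⟩
    obtain ⟨h1, h2⟩ := hN n hn.le
    have hi := integrable_abs_div_pow (hμi n) (2 * k)
    have hmap : ∫ x, (|x| / 3) ^ (2 * k) ∂(μ n) = ∫ x, (|u n x| / 3) ^ (2 * k) ∂l := by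
      conv_lhs => rw [← map_invDistribFun (μ n)]
      rw [integral_map (aemeasurable_invDistribFun (μ n)) (by fun_prop)]
    have hi' : Integrable (fun x => (|u n x| / 3) ^ (2 * k)) l := by
      rw [← map_invDistribFun (μ n)] at hi
      exact hi.comp_aemeasurable (aemeasurable_invDistribFun (μ n))
    have him : Integrable (fun x => min |u n x - v x| 5 ^ p) l := by
      refine Integrable.of_bound
        (((hmeas n).min aemeasurable_const).pow_const p).aestronglyMeasurable (5 ^ p)
        (Eventually.of_forall fun x => ?_)
      rw [Real.norm_of_nonneg (by positivity)]
      gcongr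
      exact min_le_right _ _
    have hle : ∫ x, |u n x - v x| ^ p ∂l ≤
        ∫ x, (min |u n x - v x| 5 ^ p + 6 ^ p * (|u n x| / 3) ^ (2 * k)) ∂l := by
      refine integral_mono_of_nonneg (Eventually.of_forall fun x => by positivity)
        (him.add (hi'.const_mul _)) ?_
      filter_upwards [hvb] with x hx using abs_rpow_le_min_add hp hpk hx
    rw [integral_add him (hi'.const_mul _), integral_const_mul, ← hmap] at hle
    rw [lt_div_iff₀' h6] at h1
    rw [Real.dist_0_eq_abs, abs_of_nonneg (integral_nonneg fun x => by positivity)]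
    linarith
  have heq : ∀ n, eLpNorm (u n - v) (ENNReal.ofReal p) l =
      ENNReal.ofReal ((∫ x, |u n x - v x| ^ p ∂l) ^ p⁻¹) := fun n => by
    rw [((hμp n).sub hνp).eLpNorm_eq_integral_rpow_norm (by simpa using hp0)
      ENNReal.ofReal_ne_top, ENNReal.toReal_ofReal hp0.le]
    rfl
  rw [funext heq]
  have h1 := ENNReal.tendsto_ofReal (hint.rpow_const (p := p⁻¹) (Or.inr (by positivity)))
  rwa [Real.zero_rpow (by positivity), ENNReal.ofReal_zero] at h1

end MethodOfMoments

/-! ### Assembly of the equivalences -/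

theorem ae_semicircle_abs_le_two : ∀ᵐ y ∂semicircle, |y| ≤ 2 := by
  filter_upwards [ae_semicircle_mem_Icc] with y hy using abs_le.2 hy

theorem convergesInLpUnitInterval_of_convergesInMoments {μ : ℕ → Measure ℝ}
    [∀ n, IsProbabilityMeasure (μ n)]
    (hμi : ∀ n (P : Polynomial ℝ), Integrable (fun x => P.eval x) (μ n))
    (h : ConvergesInMoments μ semicircle) {p : ℝ} (hp : 1 ≤ p) :
    ConvergesInLpUnitInterval p (fun n => invDistribFun (μ n)) (invDistribFun semicircle) := by
  have hμp := fun n => memLp_invDistribFun (μ n) hp (h.1 n p hp)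
  have hνp := memLp_invDistribFun semicircle hp (h.2.1 p hp)
  refine ⟨hμp, hνp, tendsto_eLpNorm_invDistribFun ae_semicircle_abs_le_two hμi h.2.2
    (fun x hx => ?_) hp hμp hνp⟩
  refine tendsto_invDistribFun_of_tendsto_cdf (fun t => ?_) hx fun t => cdf_semicircle_gt hx
  exact tendsto_cdf_of_tendsto_integral
    (tendsto_integral_of_tendsto_moments ae_semicircle_abs_le_two hμi
      (fun P => integrable_semicircle_of_continuous P.continuous) h.2.2) t

theorem convergesInMoments_of_convergesInWasserstein {μ : ℕ → Measure ℝ}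
    [∀ n, IsProbabilityMeasure (μ n)]
    (hμi : ∀ n (P : Polynomial ℝ), Integrable (fun x => P.eval x) (μ n))
    (h : ∀ p : ℝ, 1 ≤ p → ConvergesInWasserstein p μ semicircle) :
    ConvergesInMoments μ semicircle := by
  refine ⟨fun n p hp => (h p hp).1 n, fun p hp => (h p hp).2.1, fun P => ?_⟩
  have hpow : ∀ k : ℕ,
      Tendsto (fun n => ∫ x, x ^ k ∂(μ n)) atTop (𝓝 (∫ x, x ^ k ∂semicircle)) := by
    intro k
    rcases Nat.eq_zero_or_pos k with rfl | hk
    · simp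
    · refine tendsto_integral_pow_of_tendsto_wassersteinDist ae_semicircle_abs_le_two hk
        (fun n => ?_) (integrable_semicircle_of_continuous (by fun_prop))
        (h k (by exact_mod_cast hk)).2.2
      simpa using hμi n (Polynomial.X ^ k)
  have hsum : ∀ (m : Measure ℝ), (∀ P : Polynomial ℝ, Integrable (fun x => P.eval x) m) →
      ∫ x, P.eval x ∂m =
        ∑ i ∈ Finset.range (P.natDegree + 1), P.coeff i * ∫ x, x ^ i ∂m := by
    intro m hm
    simp only [Polynomial.eval_eq_sum_range, ← integral_const_mul]
    refine integral_finsetSum _ fun i _ => Integrable.const_mul ?_ _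
    simpa using hm (Polynomial.X ^ i)
  rw [hsum semicircle fun P => integrable_semicircle_of_continuous P.continuous]
  simp only [fun n => hsum (μ n) (hμi n)]
  exact tendsto_finsetSum _ fun i _ => (hpow i).const_mul _

theorem theorem4p2 {V D : ℕ → Type*} [∀ n, Fintype (V n)] [∀ n, DecidableEq (V n)]
    [∀ n, Nonempty (V n)] (G : ∀ n, DartGraph (V n) (D n)) (q : ℕ → ℕ) (hq : ∀ n, 1 ≤ q n)
    (hG : ∀ n, (G n).IsRegularOfDegree (q n + 1)) :
    List.TFAE [
      ∀ p : ℝ, 1 ≤ p →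
        ConvergesInWasserstein p (fun n => (G n).spectralMeasure (q n)) semicircle,
      ∀ p : ℝ, 1 ≤ p →
        ConvergesInLpUnitInterval p (fun n => invDistribFun ((G n).spectralMeasure (q n)))
          (invDistribFun semicircle),
      ConvergesInMoments (fun n => (G n).spectralMeasure (q n)) semicircle,
      Tendsto q atTop atTop ∧ ∀ r : ℕ, 1 ≤ r →
        Tendsto (fun n => (q n : ℝ) ^ (-(r : ℝ) / 2) *
          (((G n).circuitCount r : ℝ) / (Fintype.card (V n) : ℝ))) atTop (𝓝 0),
      Tendsto q atTop atTop ∧ ∀ r : ℕ, 1 ≤ r →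
        Tendsto (fun n => (q n : ℝ) ^ (-(r : ℝ) / 2) *
          (((G n).closedNBWalkCount r : ℝ) / (Fintype.card (V n) : ℝ))) atTop (𝓝 0)] := by
  have hint := fun n (P : Polynomial ℝ) => (G n).integrable_spectralMeasure (q n) fun x => P.eval x
  have hmem : ∀ n, ∀ p : ℝ, MemWassersteinSpace p ((G n).spectralMeasure (q n)) := fun n p =>
    ⟨inferInstance, (G n).integrable_spectralMeasure (q n) _⟩
  tfae_have 1 → 3 := convergesInMoments_of_convergesInWasserstein hint
  tfae_have 3 → 2 := fun h p hp => convergesInLpUnitInterval_of_convergesInMoments hint h hp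
  tfae_have 2 → 1 := fun h p hp => (h p hp).convergesInWasserstein hp (fun n => hmem n p)
    (memWassersteinSpace_semicircle hp)
  tfae_have 3 → 5 := fun h => DartGraph.tendsto_closedNBWalkCount_of_tendsto_chebyshev hq hG
    ((tendsto_integral_semicircle_iff hint).1 h.2.2)
  tfae_have 5 → 3 := fun h => ⟨fun n p _ => hmem n p, fun p hp => memWassersteinSpace_semicircle hp,
    (tendsto_integral_semicircle_iff hint).2
      (DartGraph.tendsto_chebyshev_of_tendsto_closedNBWalkCount hq hG h.1 h.2)⟩
  tfae_have 4 → 5 := fun h =>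
    ⟨h.1, DartGraph.tendsto_closedNBWalkCount_of_tendsto_circuitCount hq hG h.2⟩
  tfae_have 5 → 4 := fun h => ⟨h.1, fun r hr =>
    DartGraph.tendsto_circuitCount_of_tendsto_closedNBWalkCount hG hr (h.2 r hr)⟩
  tfae_finish
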